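/- **Conventions.** Let $W$ be a Coxeter group with simple reflections $S$, $U\subset W$ a standard parabolic subgroup. For cosets $\bar v,\bar w\in U\backslash W$ (identified by inversion with left cosets in $W/U$), let $P_{\bar v,\bar w}$ be the parabolic Kazhdan–Lusztig polynomial of antispherical type: if $N_{\bar x}$ is the standard basis and $\underline N_{\bar w}=\sum_{\bar v} P_{\bar v,\bar w}N_{\bar v}$ the Kazhdan–Lusztig basis of the module induced from the representation $H_s\mapsto -v$ of the Hecke algebra of $U$ (where $(H_s+v)(H_s-v^{-1})=0$), then $P_{\bar v,\bar w}\in\mathbb Z[v]$. Suppose $W$ acts on a space of vectors or sequences, $\rho$ is a fixed vector, $w.\lambda=w(\lambda+\rho)-\rho$, and $D$ is a set of weights containing at most one element of each $W$-orbit for the dot action. If no nontrivial $w\in W$ satisfies $w.\lambda=\lambda$ and there is $w\in W$ with $\nu=w^{-1}.\lambda\in D$, put $a^\lambda_\mu=P_{\bar v,\bar w}(1)$ if $\mu=v.\nu$ for some $v\in W$, and $a^\lambda_\mu=0$ if $\mu$ is not in the $W$-orbit of $\nu$; we then say that $a^\lambda_\mu$ is defined. A Young diagram $\lambda$ is identified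 with its vector (or infinite sequence, extended by $0$) of row lengths. Denote by $a^\lambda_\mu(M,\ell)$ ($M=2m+1$), $a^\lambda_\mu(-M,\ell)$ ($M=2m$), $a^\lambda_\mu(N)$, $a^\lambda_\mu(-N)$ the coefficients for the following data. * $a^\lambda_\mu(M,\ell)$, $M=2m+1$: $U$ is the group of signed permutations of $\mathbb R^m$; $W$ is generated by $U$ and the translations by $\ell\{x\in\mathbb Z^m: 2\mid\sum x_i\}$; $\rho=(m+\frac12-i)_{1\le i\le m}$; $D=\{\nu:\ y=\nu+\rho \text{ satisfies } y_1>\dots>y_m>0,\ y_1+y_2<\ell\}$; the simple reflections are those in the walls of this alcove. * $a^\lambda_\mu(-M,\ell)$, $M=2m$: the same $U$; translations by $2\ell\,\mathbb Z^m$; $\rho=(m+1-i)_{1\le i\le m}$; the alcove is $y_1>\dots>y_m>0$, $y_1<\ell$. * $a^\lambda_\mu(N)$, $N\ge1$: $U=S_\infty$ (finite permutations of the entries of sequences), $W=W(D_\infty)$ is generated by $S_\infty$ and $s_0(l_1,l_2,l_3,\dots)=(-l_2,-l_1,l_3,\dots)$; $\rho=(1-\frac N2-i)_{i\ge1}$;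 $D=D(N)$ is the set of Young diagrams with $\nu_1+\nu_2\le N$. * $a^\lambda_\mu(-N)$, $N\ge2$ even: $U=S_\infty$, $W=W(B_\infty)$ is generated by $S_\infty$ and $s_0(l_1,l_2,\dots)=(-l_1,l_2,\dots)$; $\rho=(-\frac N2-i)_{i\ge1}$; $D=D(N)$ is the set of Young diagrams with $\nu_1\le N/2$. In the last two cases the simple reflections are $s_0$ and the adjacent transpositions. **Lemma.** Let $N\geq 1$ be an integer and let $\lambda,\mu$ be Young diagrams. (a) Suppose that no nontrivial element of $W(D_\infty)$ fixes $\lambda$ under the dot action. Then $a^\lambda_\mu(N)$ is defined, and there is $M_0$ (depending on $N,\lambda,\mu$) such that for all odd $M\ge M_0$ the coefficient $a^\lambda_\mu(M,N+M-2)$ is defined and $$a^\lambda_\mu(M,N+M-2)=a^\lambda_\mu(N).$$ (b) Suppose that $N$ is even and that no nontrivial element of $W(B_\infty)$ fixes $\lambda$ under the dot action. Then $a^\lambda_\mu(-N)$ is defined, and there is $M_0$ (depending on $N,\lambda,\mu$) such that for all even $M\ge M_0$ the coefficient $a^\lambda_\mu(-M,(N+M+2)/2)$ is defined and $$a^\lambda_\mu(-M,(N+M+2)/2)=a^\lambda_\mu(-N).$$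 -/

import Mathlib

open scoped LaurentPolynomial

noncomputable section

namespace KLStab

/-! ### Parabolic Kazhdan-Lusztig polynomials

In this section `s : κ → Γ` is a family of elements of a group `Γ`.  All notions are applied only
when the subgroup `W` generated by the `s i` is a Coxeter group with simple reflections `s i`, and
when `U ≤ W` is a standard parabolic subgroup; the cosets that matter are those of elements
of `W`. -/

section KazhdanLusztig

variable {Γ κ : Type} [Group Γ]

/-- The length of a left coset `c = wU`: the minimal length of a word in the generators that
represents an element of `c`. -/
def cosetLength (s : κ → Γ) (U : Subgroup Γ) (c : Γ ⧸ U) : ℕ :=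
  sInf {n | ∃ l : List κ, l.length = n ∧ (((l.map s).prod : Γ) : Γ ⧸ U) = c}

open Classical in
/-- The action of the Kazhdan-Lusztig generator `C_s = H_s + v` of the Hecke algebra (over
`ℤ[v, v⁻¹]`, with `(H_s + v)(H_s - v⁻¹) = 0`) on a standard basis element `N_c` of the
antispherical module, the module induced from the representation `H_s ↦ -v` of the Hecke algebra
of `U`; its standard basis is indexed by the cosets of `U`:
`C_s N_c = 0` if `sc = c`, `C_s N_c = N_{sc} + v N_c` if `sc` is longer than `c`,
and `C_s N_c = N_{sc} + v⁻¹ N_c` if `sc` is shorter than `c`. -/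
def stdAction (s : κ → Γ) (U : Subgroup Γ) (i : κ) (c : Γ ⧸ U) : (Γ ⧸ U) →₀ ℤ[T;T⁻¹] :=
  if s i • c = c then 0
  else if cosetLength s U c < cosetLength s U (s i • c) then
    Finsupp.single (s i • c) 1 + Finsupp.single c (LaurentPolynomial.T 1)
  else
    Finsupp.single (s i • c) 1 + Finsupp.single c (LaurentPolynomial.T (-1))

/-- The action of `C_s` on the antispherical module, extended linearly. -/
def heckeAction (s : κ → Γ) (U : Subgroup Γ) (i : κ) (b : (Γ ⧸ U) →₀ ℤ[T;T⁻¹]) :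
    (Γ ⧸ U) →₀ ℤ[T;T⁻¹] :=
  b.sum fun c p => p • stdAction s U i c

variable [LinearOrder κ] [WellFoundedLT κ]

open Classical in
/-- The Kazhdan-Lusztig basis element of the antispherical module attached to the coset `c`, by
induction on the length.  If `c` is the coset of `1`, it is `N_c`.  Otherwise choose `s` with
`sc` shorter than `c` (the smallest one; the result does not depend on this choice), let `b` be the
product of `C_s` with the element attached to `sc`, and subtract from `b`, for each `d` shorter
than `c`, the element attached to `d`, multiplied by the value at `v = 0` of the coefficient of
`N_d` in `b` (a polynomial in `v`). -/
def klElement (s : κ → Γ) (U : Subgroup Γ) (c : Γ ⧸ U) : (Γ ⧸ U) →₀ ℤ[T;T⁻¹] :=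
  if h : ∃ i, cosetLength s U (s i • c) < cosetLength s U c then
    let i := wellFounded_lt.min {i | cosetLength s U (s i • c) < cosetLength s U c} h
    have _ : cosetLength s U (s i • c) < cosetLength s U c :=
      wellFounded_lt.min_mem {i | cosetLength s U (s i • c) < cosetLength s U c} h
    let b := heckeAction s U i (klElement s U (s i • c))
    b - ∑ d ∈ b.support,
      if _ : cosetLength s U d < cosetLength s U c then (b d).coeff 0 • klElement s U d else 0
  else Finsupp.single c 1
termination_by cosetLength s U c

/-- The parabolic Kazhdan-Lusztig polynomial (in Soergel's normalization, a polynomial in `v`)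
attached to the classes of `x` and `w` modulo left multiplication by `U`.  Via inversion these
classes are the left cosets `x⁻¹U` and `w⁻¹U`. -/
def parabolicKL (s : κ → Γ) (U : Subgroup Γ) (x w : Γ) : ℤ[T;T⁻¹] :=
  klElement s U ((w⁻¹ : Γ) : Γ ⧸ U) ((x⁻¹ : Γ) : Γ ⧸ U)

end KazhdanLusztig

/-! ### Reflection groups with a dot action, and the coefficients `a^λ_μ` -/

/-- A bundle of the data that occur in the definition of `a^λ_μ`: a group `W` acting on
`ι → ℝ`, its simple reflections `gen`, the subgroup `U`, the vector `ρ`, and the set `dom` of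
weights in the interior of the fundamental domain of the dot action. The four instances that are
used are defined below. -/
structure ReflectionDatum (ι κ : Type) where
  gen : κ → Equiv.Perm (ι → ℝ)
  W : Subgroup (Equiv.Perm (ι → ℝ))
  U : Subgroup (Equiv.Perm (ι → ℝ))
  rho : ι → ℝ
  dom : Set (ι → ℝ)

namespace ReflectionDatum

variable {ι κ : Type} (R : ReflectionDatum ι κ)

/-- The dot action `w.x = w(x + ρ) - ρ`. -/
def dot (w : Equiv.Perm (ι → ℝ)) (x : ι → ℝ) : ι → ℝ := w (x + R.rho) - R.rho

/-- No nontrivial element of `W` fixes `x` under the dot action. -/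
def Regular (x : ι → ℝ) : Prop := ∀ w ∈ R.W, R.dot w x = x → w = 1

/-- The conditions on `λ` under which the coefficients `a^λ_μ` are defined. -/
def Admissible (x : ι → ℝ) : Prop := R.Regular x ∧ ∃ w ∈ R.W, R.dot w⁻¹ x ∈ R.dom

open Classical in
/-- The coefficient `a^x_y`: if there are `w, u ∈ W` with `ν = w⁻¹.x ∈ dom` and `u.ν = y`, it is
the value at `1` of the parabolic Kazhdan-Lusztig polynomial of the classes of `u` and `w`;
otherwise it is `0`. -/
def coeff [LinearOrder κ] [WellFoundedLT κ] (x y : ι → ℝ) : ℤ :=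
  if h : ∃ p : Equiv.Perm (ι → ℝ) × Equiv.Perm (ι → ℝ), p.1 ∈ R.W ∧ p.2 ∈ R.W ∧
      R.dot p.1⁻¹ x ∈ R.dom ∧ R.dot p.2 (R.dot p.1⁻¹ x) = y then
    LaurentPolynomial.eval₂ (RingHom.id ℤ) 1 (parabolicKL R.gen R.U h.choose.2 h.choose.1)
  else 0

end ReflectionDatum

/-! ### Permutations, sign changes, translations, affine reflections -/

section Maps

variable {ι : Type}

/-- Permutation of the coordinates. -/
def permMap (σ : Equiv.Perm ι) : Equiv.Perm (ι → ℝ) := Equiv.arrowCongr σ (Equiv.refl ℝ)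

/-- Sign changes of the coordinates. -/
def signMap (ε : ι → ℤˣ) : Equiv.Perm (ι → ℝ) :=
  Equiv.piCongrRight fun i => MulAction.toPerm (ε i)

/-- The reflection of `ℝ^m` in the hyperplane `{x | α · x = k}`. -/
def affineReflection {m : ℕ} (α : Fin m → ℝ) (k : ℝ) : Equiv.Perm (Fin m → ℝ) :=
  Function.Involutive.toPerm (fun x => x - (2 * (α ⬝ᵥ x - k) / (α ⬝ᵥ α)) • α) (by
    intro x
    by_cases h : α ⬝ᵥ α = 0
    · simp [h]
    · simp only [dotProduct_sub, dotProduct_smul, smul_eq_mul, sub_sub, ← add_smul]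
      rw [sub_eq_self]
      convert zero_smul ℝ α
      field_simp
      ring)

end Maps

/-! ### The affine Weyl groups of types `B_m` and `C_m` -/

/-- The Weyl group `W(m)` of type `B_m` (and `C_m`): signed permutations of the coordinates. -/
def weylB (m : ℕ) : Subgroup (Equiv.Perm (Fin m → ℝ)) :=
  Subgroup.closure (Set.range permMap ∪ Set.range signMap)

/-- The coroot lattice of type `B_m`: integer vectors with even coordinate sum. -/
def latticeB (m : ℕ) : Set (Fin m → ℝ) :=
  {v | ∃ z : Fin m → ℤ, Even (∑ i, z i) ∧ v = fun i => (z i : ℝ)}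

/-- The coroot lattice of type `C_m`, `2 ℤ^m`. -/
def latticeC (m : ℕ) : Set (Fin m → ℝ) :=
  {v | ∃ z : Fin m → ℤ, v = fun i => 2 * (z i : ℝ)}

/-- The affine reflection group generated by `W(m)` and the translations by `ℓ L`. -/
def affineWeyl (m ℓ : ℕ) (L : Set (Fin m → ℝ)) : Subgroup (Equiv.Perm (Fin m → ℝ)) :=
  weylB m ⊔ Subgroup.closure {t | ∃ v ∈ L, t = Equiv.addLeft ((ℓ : ℝ) • v)}

/-- For `1 ≤ i < m` the vector `e_i - e_{i+1}`, and for `i = m` the vector `e_m` (coordinates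
being counted from `1`). -/
def simpleRoot (m i : ℕ) : Fin m → ℝ :=
  fun j => if j.val + 1 = i then 1 else if j.val = i then -1 else 0

/-- Half the sum of the positive roots of type `B_m`: `ρ_i = m + 1/2 - i` for `1 ≤ i ≤ m`. -/
def rhoB (m : ℕ) : Fin m → ℝ := fun i => (m : ℝ) + 1 / 2 - ((i.val : ℝ) + 1)

/-- Half the sum of the positive roots of type `C_m`: `ρ_i = m + 1 - i` for `1 ≤ i ≤ m`. -/
def rhoC (m : ℕ) : Fin m → ℝ := fun i => (m : ℝ) + 1 - ((i.val : ℝ) + 1)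

/-- The open alcove `y₁ > … > y_m > 0`, `y₁ + y₂ < ℓ`. -/
def alcoveB (m ℓ : ℕ) : Set (Fin m → ℝ) :=
  {y | (∀ i j, i < j → y j < y i) ∧ (∀ i, 0 < y i) ∧
    ∀ i j : Fin m, i.val = 0 → j.val = 1 → y i + y j < ℓ}

/-- The open alcove `y₁ > … > y_m > 0`, `y₁ < ℓ`. -/
def alcoveC (m ℓ : ℕ) : Set (Fin m → ℝ) :=
  {y | (∀ i j, i < j → y j < y i) ∧ (∀ i, 0 < y i) ∧ ∀ i : Fin m, i.val = 0 → y i < ℓ}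

/-- Type `B_m`, group `SO(2m+1)`. The first generator is the reflection in the hyperplane
`y₁ + y₂ = ℓ`. -/
def affineB (m ℓ : ℕ) : ReflectionDatum (Fin m) (Fin (m + 1)) where
  gen i :=
    if i.val = 0 then affineReflection (fun j => if j.val < 2 then 1 else 0) ℓ
    else affineReflection (simpleRoot m i.val) 0
  W := affineWeyl m ℓ (latticeB m)
  U := weylB m
  rho := rhoB m
  dom := {x | x + rhoB m ∈ alcoveB m ℓ}

/-- Type `C_m`, group `Sp(2m)`. The first generator is the reflection in the hyperplane
`y₁ = ℓ`. -/
def affineC (m ℓ : ℕ) : ReflectionDatum (Fin m) (Fin (m + 1)) where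
  gen i :=
    if i.val = 0 then affineReflection (fun j => if j.val = 0 then 1 else 0) ℓ
    else affineReflection (simpleRoot m i.val) 0
  W := affineWeyl m ℓ (latticeC m)
  U := weylB m
  rho := rhoC m
  dom := {x | x + rhoC m ∈ alcoveC m ℓ}

/-! ### The limiting reflection groups -/

/-- `S_∞`: finite permutations of the entries of a sequence. -/
def symInfty : Subgroup (Equiv.Perm (ℕ → ℝ)) :=
  Subgroup.closure {g | ∃ σ : Equiv.Perm ℕ, {i | σ i ≠ i}.Finite ∧ g = permMap σ}

/-- `(l₁, l₂, l₃, …) ↦ (-l₂, -l₁, l₃, …)`. -/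
def reflD : Equiv.Perm (ℕ → ℝ) :=
  signMap (fun i => if i < 2 then -1 else 1) * permMap (Equiv.swap 0 1)

/-- `(l₁, l₂, l₃, …) ↦ (-l₁, l₂, l₃, …)`. -/
def reflB : Equiv.Perm (ℕ → ℝ) := signMap fun i => if i = 0 then -1 else 1

/-- The simple reflections of `W(D_∞)` or `W(B_∞)`: the special reflection `s₀` and the adjacent
transpositions. -/
def genInfty (s₀ : Equiv.Perm (ℕ → ℝ)) : ℕ → Equiv.Perm (ℕ → ℝ)
  | 0 => s₀
  | i + 1 => permMap (Equiv.swap i (i + 1))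

/-- A Young diagram as the infinite sequence of its row lengths. -/
def seq (lam : YoungDiagram) : ℕ → ℝ := fun i => lam.rowLen i

/-- A Young diagram as the vector of its first `m` row lengths. -/
def vec (m : ℕ) (lam : YoungDiagram) : Fin m → ℝ := fun i => lam.rowLen i

/-- `S_∞ ⊂ W(D_∞)`, with `ρ_i = 1 - N/2 - i` for `i ≥ 1`; the set `D(N)` consists of the Young
diagrams with at most `N` boxes in the first two rows. -/
def limitD (N : ℕ) : ReflectionDatum ℕ ℕ where
  gen := genInfty reflD
  W := symInfty ⊔ Subgroup.closure {reflD}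
  U := symInfty
  rho := fun i => 1 - (N : ℝ) / 2 - ((i : ℝ) + 1)
  dom := {x | ∃ nu : YoungDiagram, nu.rowLen 0 + nu.rowLen 1 ≤ N ∧ x = seq nu}

/-- `S_∞ ⊂ W(B_∞)`, with `ρ_i = -N/2 - i` for `i ≥ 1`; the set `D(N)` consists of the Young
diagrams with at most `N/2` boxes in the first row (`N` even). -/
def limitB (N : ℕ) : ReflectionDatum ℕ ℕ where
  gen := genInfty reflB
  W := symInfty ⊔ Subgroup.closure {reflB}
  U := symInfty
  rho := fun i => -(N : ℝ) / 2 - ((i : ℝ) + 1)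
  dom := {x | ∃ nu : YoungDiagram, 2 * nu.rowLen 0 ≤ N ∧ x = seq nu}

/-! ### The coefficients -/

/-- `a^λ_μ(M, ℓ)` for `SO(M)`, `M` odd. -/
def aSO (M ℓ : ℕ) (lam mu : YoungDiagram) : ℤ :=
  (affineB (M / 2) ℓ).coeff (vec (M / 2) lam) (vec (M / 2) mu)

/-- `a^λ_μ(-M, ℓ)` for `Sp(M)`, `M` even. -/
def aSp (M ℓ : ℕ) (lam mu : YoungDiagram) : ℤ :=
  (affineC (M / 2) ℓ).coeff (vec (M / 2) lam) (vec (M / 2) mu)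

/-- `a^λ_μ(N)`. -/
def aSOlim (N : ℕ) (lam mu : YoungDiagram) : ℤ := (limitD N).coeff (seq lam) (seq mu)

/-- `a^λ_μ(-N)`, `N` even. -/
def aSplim (N : ℕ) (lam mu : YoungDiagram) : ℤ := (limitB N).coeff (seq lam) (seq mu)

end KLStab

end

open scoped LaurentPolynomial

noncomputable section

/-! With `d = 2` in (a) and `d = 1` in (b), all four reflection data have one shape. Shifting the
first `m` coordinates by `ℓ / d` turns sign changes into reflections `a ↦ 2ℓ/d - a`, so it matches
the first `m` simple reflections of the limiting group with those of the affine group; for the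
prescribed `ℓ` it also matches the two vectors `ρ`. The affine group has one further generator, the
sign change of the last coordinate. The limiting elements linking `λ`, `μ` and the dominant weight
`ν` are words in finitely many generators, so for large `m` they have affine counterparts
(`affine_word_embed`).

For a coset reached by the first `k` generators, the Kazhdan–Lusztig recursion only meets cosets of
the same kind (`Realization.klElement_eq`). In both groups these are modelled by finite sets `A ⊆
{0, …, k - 1}` with `d ∣ |A|`, with the same action and the same length (`limit_realization`,
`affine_realization`). Length refers to all generators, so it must be shown that the extra ones
never shorten a coset. Hence the polynomials agree (`parabolicKL_eq`).

It remains to compare when the coefficients are defined and when they vanish. Regularity yields a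
dominant `ν` by sorting absolute values (`limit_exists_dom`), and both actions are free on their
domains, so the choices in the definition do not matter (`limit_freeOnDom`, `affine_freeOnDom`). For
large `m` the shifted `ν` and `μ` have entries between `0` and `2ℓ/d`, which forces any affine
relation between them to come from the limiting group (`exists_limit_of_affine`). -/

namespace KLStab

/-! ### Kazhdan–Lusztig elements computed in a combinatorial model. -/

section Transfer

variable {Γ κ X : Type} [Group Γ] {k : ℕ}

/-- A combinatorial model `(X, t, wt)` of a set of cosets that is stable under the first `k`
generators: `t i` is the action of the `i`-th generator and `wt` is the length. -/
structure Realization [LinearOrder κ] (s : κ → Γ) (U : Subgroup Γ) (e : Fin k → κ)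
    (t : Fin k → X → X) (wt : X → ℕ) (f : X → Γ ⧸ U) : Prop where
  strictMono : StrictMono e
  -- `klElement` uses the smallest descent, so the model has to contain every generator below one of
  -- its own.
  lower : ∀ i j, i ≤ e j → i ∈ Set.range e
  injective : Function.Injective f
  map_step : ∀ i x, f (t i x) = s (e i) • f x
  length : ∀ x, cosetLength s U (f x) = wt x
  descent : ∀ x, wt x ≠ 0 → ∃ i, wt (t i x) < wt x

open Classical in
/-- The counterpart of `stdAction` in a combinatorial model. -/
def stepAction (t : Fin k → X → X) (wt : X → ℕ) (i : Fin k) (x : X) : X →₀ ℤ[T;T⁻¹] :=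
  if t i x = x then 0
  else if wt x < wt (t i x) then
    Finsupp.single (t i x) 1 + Finsupp.single x (LaurentPolynomial.T 1)
  else
    Finsupp.single (t i x) 1 + Finsupp.single x (LaurentPolynomial.T (-1))

open Classical in
/-- The counterpart of `klElement` in a combinatorial model. -/
def modelKL (t : Fin k → X → X) (wt : X → ℕ) (x : X) : X →₀ ℤ[T;T⁻¹] :=
  if h : ∃ i, wt (t i x) < wt x then
    let i := wellFounded_lt.min {i | wt (t i x) < wt x} h
    have _ : wt (t i x) < wt x := wellFounded_lt.min_mem {i | wt (t i x) < wt x} h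
    let b := (modelKL t wt (t i x)).sum fun y p => p • stepAction t wt i y
    b - ∑ d ∈ b.support,
      if _ : wt d < wt x then (b d).coeff 0 • modelKL t wt d else 0
  else Finsupp.single x 1
termination_by wt x

variable [LinearOrder κ] {s : κ → Γ} {U : Subgroup Γ} {e : Fin k → κ}
  {t : Fin k → X → X} {wt : X → ℕ} {f : X → Γ ⧸ U}

namespace Realization

theorem stdAction_eq (h : Realization s U e t wt f) (i : Fin k) (x : X) :
    stdAction s U (e i) (f x) = Finsupp.mapDomain f (stepAction t wt i x) := by
  have hfix : s (e i) • f x = f x ↔ t i x = x := by rw [← h.map_step, h.injective.eq_iff]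
  unfold stdAction stepAction
  by_cases hx : t i x = x
  · rw [if_pos hx, if_pos (hfix.2 hx), Finsupp.mapDomain_zero]
  · rw [if_neg hx, if_neg (hx ∘ hfix.1), ← h.map_step, h.length, h.length]
    split_ifs <;> simp [Finsupp.mapDomain_add, Finsupp.mapDomain_single]

theorem heckeAction_eq (h : Realization s U e t wt f) (i : Fin k) (b : X →₀ ℤ[T;T⁻¹]) :
    heckeAction s U (e i) (Finsupp.mapDomain f b) =
      Finsupp.mapDomain f (b.sum fun y p => p • stepAction t wt i y) := by
  unfold heckeAction
  rw [Finsupp.sum_mapDomain_index (by simp) (by intros; rw [add_smul])]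
  simp only [Finsupp.sum, Finsupp.mapDomain_finsetSum, Finsupp.mapDomain_smul, h.stdAction_eq]

variable [WellFoundedLT κ]

/-- Induction on the weight. Since the generators of the model form an initial segment, the smallest
descent of a modelled coset is one of them; the action then stays inside the image of `f`, and every
subtracted term is covered by the induction hypothesis. -/
theorem klElement_eq (h : Realization s U e t wt f) (x : X) :
    klElement s U (f x) = Finsupp.mapDomain f (modelKL t wt x) := by
  classical
  induction hn : wt x using Nat.strong_induction_on generalizing x with
  | _ n ih =>
  subst hn
  rw [klElement, modelKL]
  by_cases h0 : ∃ i, wt (t i x) < wt x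
  · have h1 : ∃ i, cosetLength s U (s i • f x) < cosetLength s U (f x) := by
      obtain ⟨i, hi⟩ := h0
      exact ⟨e i, by rwa [← h.map_step, h.length, h.length]⟩
    rw [dif_pos h0, dif_pos h1]
    have hmin : wellFounded_lt.min {i | cosetLength s U (s i • f x) < cosetLength s U (f x)} h1
        = e (wellFounded_lt.min {i | wt (t i x) < wt x} h0) := by
      set j := wellFounded_lt.min {i | wt (t i x) < wt x} h0 with hj
      have hjm : wt (t j x) < wt x := wellFounded_lt.min_mem {i | wt (t i x) < wt x} h0
      set i := wellFounded_lt.min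
        {i | cosetLength s U (s i • f x) < cosetLength s U (f x)} h1 with hi
      have him : cosetLength s U (s i • f x) < cosetLength s U (f x) :=
        wellFounded_lt.min_mem {i | cosetLength s U (s i • f x) < cosetLength s U (f x)} h1
      have hle : i ≤ e j := by
        refine not_lt.1 (wellFounded_lt.not_lt_min
          {i | cosetLength s U (s i • f x) < cosetLength s U (f x)} ?_)
        show cosetLength s U (s (e j) • f x) < cosetLength s U (f x)
        rwa [← h.map_step, h.length, h.length]
      obtain ⟨j', hj'⟩ := h.lower _ _ hle
      rw [← hj', ← h.map_step, h.length, h.length] at him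
      have : j ≤ j' := not_lt.1 (wellFounded_lt.not_lt_min {i | wt (t i x) < wt x} him)
      exact le_antisymm hle (hj' ▸ h.strictMono.monotone this)
    have hjm := wellFounded_lt.min_mem {i | wt (t i x) < wt x} h0
    simp only [hmin]
    generalize wellFounded_lt.min {i | wt (t i x) < wt x} h0 = j at hjm ⊢
    rw [← h.map_step, ih _ hjm _ rfl, h.heckeAction_eq]
    generalize ((modelKL t wt (t j x)).sum fun y p => p • stepAction t wt j y) = b
    rw [Finsupp.mapDomain_sub, Finsupp.mapDomain_finsetSum,
      Finsupp.mapDomain_support_of_injective h.injective, Finset.sum_image h.injective.injOn]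
    congr 1
    refine Finset.sum_congr rfl fun d _ => ?_
    simp only [h.length, Finsupp.mapDomain_apply h.injective]
    split_ifs with hd
    · rw [ih _ hd _ rfl, Finsupp.mapDomain_smul]
    · simp
  · have h1 : ¬ ∃ i, cosetLength s U (s i • f x) < cosetLength s U (f x) := by
      -- A coset with a shorter neighbour has nonzero length, so `descent` supplies a descent inside
      -- the model.
      rintro ⟨i, hi⟩
      rw [h.length x] at hi
      exact h0 (h.descent x (by omega))
    rw [dif_neg h0, dif_neg h1, Finsupp.mapDomain_single]

theorem klElement_apply (h : Realization s U e t wt f) (x y : X) :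
    klElement s U (f x) (f y) = modelKL t wt x y := by
  rw [h.klElement_eq, Finsupp.mapDomain_apply h.injective]

end Realization

end Transfer

/-! ### Cosets as points of an orbit. -/

section Realize

variable {V κ X : Type} {k : ℕ}

/-- A descent lowers the weight by exactly one, because undoing it raises the weight by at most one;
a chain of descents down to `x₀` therefore spells a word of the right length. -/
theorem exists_word_of_descent {t : Fin k → X → X} {wt : X → ℕ} {x₀ : X} (h₀ : wt x₀ = 0)
    (hdesc : ∀ x, x ≠ x₀ → ∃ i, wt (t i x) < wt x) (hinv : ∀ i x, t i (t i x) = x)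
    (hle : ∀ i x, wt (t i x) ≤ wt x + 1) (x : X) :
    ∃ l : List (Fin k), l.length = wt x ∧ l.foldr t x₀ = x := by
  induction hn : wt x using Nat.strong_induction_on generalizing x with
  | _ n ih =>
  subst hn
  by_cases hx : x = x₀
  · exact ⟨[], by simp [hx, h₀]⟩
  · obtain ⟨i, hi⟩ := hdesc x hx
    obtain ⟨l, hl, hlx⟩ := ih _ hi _ rfl
    refine ⟨i :: l, ?_, by simp [hlx, hinv]⟩
    have := hle i (t i x)
    rw [hinv] at this
    simp only [List.length_cons]
    omega

theorem word_apply {s : κ → Equiv.Perm V} {e : Fin k → κ} {t : Fin k → X → X} {P : X → V}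
    (hstep : ∀ i x, s (e i) (P x) = P (t i x)) (l : List (Fin k)) (x : X) :
    ((l.map e).map s).prod (P x) = P (l.foldr t x) := by
  induction l with
  | nil => rfl
  | cons i l ih => simp only [List.map_cons, List.prod_cons, Equiv.Perm.mul_apply, ih, hstep,
      List.foldr_cons]

/-- If the first `k` generators act on the orbit of a point with stabilizer `U` as in a
combinatorial model, then the model describes cosets of `U`. -/
theorem exists_realization [LinearOrder κ] {s : κ → Equiv.Perm V} {W U : Subgroup (Equiv.Perm V)}
    {e : Fin k → κ} {t : Fin k → X → X} {wt : X → ℕ} {x₀ : X} {P : X → V}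
    (hs : ∀ i, s i ∈ W) (he : StrictMono e) (hlow : ∀ i j, i ≤ e j → i ∈ Set.range e)
    (hP : Function.Injective P) (hstep : ∀ i x, s (e i) (P x) = P (t i x))
    (hU : ∀ u ∈ U, u (P x₀) = P x₀) (hW : ∀ w ∈ W, w (P x₀) = P x₀ → w ∈ U)
    (hlen : ∀ (l : List κ) x, (l.map s).prod (P x₀) = P x → wt x ≤ l.length)
    (h₀ : wt x₀ = 0) (hdesc : ∀ x, x ≠ x₀ → ∃ i, wt (t i x) < wt x)
    (hinv : ∀ i x, t i (t i x) = x) (hle : ∀ i x, wt (t i x) ≤ wt x + 1) :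
    ∃ f : X → Equiv.Perm V ⧸ U, Realization s U e t wt f ∧
      ∀ w ∈ W, ∀ x, w (P x₀) = P x → (w : Equiv.Perm V ⧸ U) = f x := by
  choose word hword hfold using exists_word_of_descent h₀ hdesc hinv hle
  have hprod : ∀ x, (((word x).map e).map s).prod (P x₀) = P x := fun x => by
    rw [word_apply hstep, hfold]
  have hmem : ∀ x, (((word x).map e).map s).prod ∈ W := fun x =>
    Subgroup.list_prod_mem _ (by simpa using fun i _ => hs _)
  have key : ∀ w ∈ W, ∀ x, w (P x₀) = P x →
      (w : Equiv.Perm V ⧸ U) = ((((word x).map e).map s).prod : Equiv.Perm V) := by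
    intro w hw x hx
    refine QuotientGroup.eq.2 (hW _ (mul_mem (inv_mem hw) (hmem x)) ?_)
    rw [Equiv.Perm.mul_apply, hprod, Equiv.Perm.inv_eq_iff_eq, hx]
  refine ⟨fun x => ((((word x).map e).map s).prod : Equiv.Perm V),
    ⟨he, hlow, ?_, ?_, ?_, ?_⟩, key⟩
  · intro x y hxy
    have := QuotientGroup.eq.1 hxy
    have h := hU _ this
    rw [Equiv.Perm.mul_apply, Equiv.Perm.inv_eq_iff_eq, hprod, hprod] at h
    exact hP h.symm
  · intro i x
    refine (key _ (mul_mem (hs (e i)) (hmem x)) _ ?_).symm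
    rw [Equiv.Perm.mul_apply, hprod, hstep]
  · intro x
    refine le_antisymm (Nat.sInf_le ⟨(word x).map e, by simp [hword], rfl⟩) ?_
    -- `hlen` covers words in all generators, so those outside the model cannot shorten a coset.
    refine le_csInf ⟨_, (word x).map e, rfl, rfl⟩ ?_
    rintro n ⟨l, rfl, hl⟩
    refine hlen l x ?_
    have h := hU _ (QuotientGroup.eq.1 hl)
    rw [Equiv.Perm.mul_apply, Equiv.Perm.inv_eq_iff_eq, hprod] at h
    exact h.symm
  · intro x hx
    exact hdesc x fun h => hx (h ▸ h₀)

end Realize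

/-! ### Finite sets: action of the generators, weight and descents. -/

section Model

/-- The action of the transposition of `j` and `j + 1` on finite sets. -/
def swapStep (j : ℕ) (A : Finset ℕ) : Finset ℕ :=
  if j ∈ A ∧ j + 1 ∉ A then insert (j + 1) (A.erase j)
  else if j + 1 ∈ A ∧ j ∉ A then insert j (A.erase (j + 1)) else A

/-- The action of the special reflection on finite sets: `A` is regarded as the set of negative
coordinates of a sign vector. -/
def flipStep (d : ℕ) (A : Finset ℕ) : Finset ℕ :=
  if Finset.range d ⊆ A then A \ Finset.range d
  else if Disjoint A (Finset.range d) then A ∪ Finset.range d else A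

/-- The action of the generators on finite sets. -/
def step (d : ℕ) : ℕ → Finset ℕ → Finset ℕ
  | 0 => flipStep d
  | j + 1 => swapStep j

/-- The length of the coset attached to a finite set. -/
def weight (d : ℕ) (A : Finset ℕ) : ℕ := ∑ a ∈ A, (a + (2 - d))

theorem mem_swapStep {j i : ℕ} {A : Finset ℕ} :
    i ∈ swapStep j A ↔ Equiv.swap j (j + 1) i ∈ A := by
  unfold swapStep
  rw [Equiv.swap_apply_def]
  split_ifs <;> grind

variable {d : ℕ}

/-- For `d = 2`, a set containing exactly one of `0, 1` is unchanged by exchanging these indices and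
complementing; this is why `flipStep` leaves such sets alone. -/
theorem mem_flipStep (hd : d = 1 ∨ d = 2) {i : ℕ} {A : Finset ℕ} :
    i ∈ flipStep d A ↔ if i < d then d - 1 - i ∉ A else i ∈ A := by
  unfold flipStep
  rcases hd with rfl | rfl
  · simp only [Finset.range_one, Finset.singleton_subset_iff, Finset.disjoint_singleton_right]
    split_ifs <;> grind
  · have h2 : Finset.range 2 = {0, 1} := rfl
    simp only [h2, Finset.insert_subset_iff, Finset.singleton_subset_iff,
      Finset.disjoint_insert_right, Finset.disjoint_singleton_right]
    have : i < 2 ↔ i = 0 ∨ i = 1 := by omega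
    split_ifs <;> simp <;> grind

theorem step_step (hd : d = 1 ∨ d = 2) (i : ℕ) (A : Finset ℕ) : step d i (step d i A) = A := by
  ext a
  cases i with
  | zero =>
    simp only [step, mem_flipStep hd]
    by_cases ha : a < d
    · have h1 : d - 1 - a < d := by omega
      have h2 : d - 1 - (d - 1 - a) = a := by omega
      simp [ha, h1, h2]
    · simp [ha]
  | succ j => simp [step, mem_swapStep]

theorem step_subset (hd : d = 1 ∨ d = 2) {k : ℕ} (hk : d ≤ k) {i : ℕ} (hi : i < k)
    {A : Finset ℕ} (hA : A ⊆ Finset.range k) : step d i A ⊆ Finset.range k := by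
  intro a ha
  cases i with
  | zero =>
    rw [step, mem_flipStep hd] at ha
    split_ifs at ha
    · simp; omega
    · exact hA ha
  | succ j =>
    rw [step, mem_swapStep] at ha
    have := Finset.mem_range.1 (hA ha)
    rw [Equiv.swap_apply_def] at this
    simp only [Finset.mem_range]
    split_ifs at this <;> omega

theorem dvd_card_step (i : ℕ) {A : Finset ℕ} (hA : d ∣ A.card) :
    d ∣ (step d i A).card := by
  cases i with
  | zero =>
    simp only [step, flipStep]
    split_ifs with h1 h2
    · rw [Finset.card_sdiff_of_subset h1, Finset.card_range]
      exact Nat.dvd_sub hA dvd_rfl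
    · rw [Finset.card_union_of_disjoint h2, Finset.card_range]
      exact dvd_add hA dvd_rfl
    · exact hA
  | succ j =>
    simp only [step, swapStep]
    split_ifs with h1 h2
    · rw [Finset.card_insert_of_notMem (by simp [h1.2]), Finset.card_erase_add_one h1.1]
      exact hA
    · rw [Finset.card_insert_of_notMem (by simp [h2.2]), Finset.card_erase_add_one h2.1]
      exact hA
    · exact hA

theorem sum_range_weight (hd : d = 1 ∨ d = 2) : ∑ a ∈ Finset.range d, (a + (2 - d)) = 1 := by
  rcases hd with rfl | rfl <;> decide

theorem weight_flipStep_of_subset (hd : d = 1 ∨ d = 2) {A : Finset ℕ} (h : Finset.range d ⊆ A) :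
    weight d (flipStep d A) + 1 = weight d A := by
  rw [flipStep, if_pos h, weight, weight, ← sum_range_weight hd, Finset.sum_sdiff h]

theorem weight_swapStep_of_mem {j : ℕ} {A : Finset ℕ} (h : j + 1 ∈ A) (h' : j ∉ A) :
    weight d (swapStep j A) + 1 = weight d A := by
  rw [swapStep, if_neg (by tauto), if_pos ⟨h, h'⟩, weight, weight,
    Finset.sum_insert (by simp [h']), ← Finset.add_sum_erase _ _ h]
  ring

theorem weight_step_le (hd : d = 1 ∨ d = 2) (i : ℕ) (A : Finset ℕ) :
    weight d (step d i A) ≤ weight d A + 1 := by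
  cases i with
  | zero =>
    by_cases h1 : Finset.range d ⊆ A
    · have := weight_flipStep_of_subset hd h1
      simp only [step]; omega
    · simp only [step, flipStep, if_neg h1]
      split_ifs with h2
      · rw [weight, Finset.sum_union h2, sum_range_weight hd, weight]
      · omega
  | succ j =>
    by_cases h1 : j + 1 ∈ A ∧ j ∉ A
    · have := weight_swapStep_of_mem (d := d) h1.1 h1.2
      simp only [step]; omega
    · simp only [step, swapStep, if_neg h1]
      split_ifs with h2
      · rw [weight, weight, Finset.sum_insert (by simp [h2.2]), ← Finset.add_sum_erase _ _ h2.1]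
        omega
      · omega

/-- If no transposition moves an element down, `A` is an initial segment. Being nonempty with `d ∣
|A|`, it contains `range d`, and the flip removes that block. -/
theorem exists_weight_step_lt (hd : d = 1 ∨ d = 2) {k : ℕ} {A : Finset ℕ}
    (hA : A ⊆ Finset.range k) (hc : d ∣ A.card) (hne : A ≠ ∅) :
    ∃ i < k, weight d (step d i A) < weight d A := by
  by_cases h : ∃ j, j + 1 ∈ A ∧ j ∉ A
  · obtain ⟨j, h1, h2⟩ := h
    refine ⟨j + 1, Finset.mem_range.1 (hA h1), ?_⟩
    have := weight_swapStep_of_mem (d := d) h1 h2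
    simp only [step]; omega
  · push Not at h
    have hdown : ∀ n i, i + n ∈ A → i ∈ A := by
      intro n
      induction n with
      | zero => exact fun i hi => hi
      | succ n ih => exact fun i hi => ih i (h _ hi)
    obtain ⟨a, ha⟩ := Finset.nonempty_iff_ne_empty.2 hne
    have h0 : 0 ∈ A := hdown a 0 (by simpa using ha)
    have hsub : Finset.range d ⊆ A := by
      rcases hd with rfl | rfl
      · simpa using h0
      · have h1 : 1 < A.card := by
          have : 0 < A.card := Finset.card_pos.2 ⟨a, ha⟩
          omega
        obtain ⟨b, hb, hb0⟩ := Finset.exists_mem_ne h1 0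
        have h1A : 1 ∈ A := hdown (b - 1) 1 (by rwa [Nat.add_sub_cancel' (by omega)])
        intro i hi
        have : i = 0 ∨ i = 1 := by have := Finset.mem_range.1 hi; omega
        rcases this with rfl | rfl <;> assumption
    refine ⟨0, by have := Finset.mem_range.1 (hA h0); omega, ?_⟩
    have := weight_flipStep_of_subset hd hsub
    simp only [step]; omega

/-- The finite sets that correspond to elements of the parabolic subgroup generated by the first
`k` generators. -/
abbrev Model (d k : ℕ) : Type := {A : Finset ℕ // A ⊆ Finset.range k ∧ d ∣ A.card}

/-- The empty set, which corresponds to the trivial coset. -/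
def Model.base (d k : ℕ) : Model d k := ⟨∅, by simp⟩

/-- The action of the first `k` generators on `Model d k`. -/
def Model.step (hd : d = 1 ∨ d = 2) {k : ℕ} (hk : d ≤ k) (i : Fin k) (x : Model d k) :
    Model d k :=
  ⟨KLStab.step d i x.1, step_subset hd hk i.2 x.2.1, dvd_card_step _ x.2.2⟩

end Model

/-! ### A common description of the four reflection data

The parameter `d` is `2` for the types `D_∞` and `B_m`, and `1` for the types `B_∞` and `C_m`. -/

/-- The special reflection of the limiting group. -/
def specialRefl (d : ℕ) : Equiv.Perm (ℕ → ℝ) := if d = 1 then reflB else reflD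

/-- The limiting reflection datum with `ρ = (r, r - 1, r - 2, …)`. -/
def limitDatum (d : ℕ) (r : ℝ) : ReflectionDatum ℕ ℕ where
  gen := genInfty (specialRefl d)
  W := symInfty ⊔ Subgroup.closure {specialRefl d}
  U := symInfty
  rho := fun i => r - i
  dom := {x | ∃ nu : YoungDiagram,
    (nu.rowLen 0 + nu.rowLen (d - 1) + 2 * r < ((d - 1 : ℕ) : ℝ)) ∧ x = seq nu}

/-- The coroot lattice. -/
def coLattice (d m : ℕ) : Set (Fin m → ℝ) := if d = 1 then latticeC m else latticeB m

/-- The affine reflection datum with `ρ = (r, r - 1, r - 2, …) + ℓ / d`. -/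
def affineDatum (d m ℓ : ℕ) (r : ℝ) : ReflectionDatum (Fin m) (Fin (m + 1)) where
  gen i :=
    if i.val = 0 then affineReflection (fun j => if j.val < d then 1 else 0) ℓ
    else affineReflection (simpleRoot m i.val) 0
  W := affineWeyl m ℓ (coLattice d m)
  U := weylB m
  rho := fun i => r - i + ℓ / d
  dom := {x | (∀ i j : Fin m, i < j → x j + (r - j + ℓ / d) < x i + (r - i + ℓ / d)) ∧
    (∀ i : Fin m, 0 < x i + (r - i + ℓ / d)) ∧ ∀ i j : Fin m, i.val = 0 → j.val = d - 1 →
      (x i + (r - i + ℓ / d)) + (x j + (r - j + ℓ / d)) < 2 * (ℓ / d : ℝ)}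

/-- The permutation of the coordinates underlying a simple reflection. -/
def genPerm (d : ℕ) : ℕ → Equiv.Perm ℕ
  | 0 => Equiv.swap 0 (d - 1)
  | j + 1 => Equiv.swap j (j + 1)

theorem genPerm_lt {d m n i : ℕ} (hd : 0 < d) (hdm : d ≤ m) (hn : n < m) (hi : i < m) :
    genPerm d n i < m := by
  cases n <;> simp only [genPerm, Equiv.swap_apply_def] <;> split_ifs <;> omega

/-- One formula for both kinds of generator, in the form in which sign sets and parity sets are
later compared with the model. -/
theorem mem_step {d : ℕ} (hd : d = 1 ∨ d = 2) {n i : ℕ} {A : Finset ℕ} :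
    i ∈ step d n A ↔ if n = 0 ∧ i < d then genPerm d n i ∉ A else genPerm d n i ∈ A := by
  cases n with
  | zero =>
    rw [step, mem_flipStep hd, genPerm]
    have : i < d → Equiv.swap 0 (d - 1) i = d - 1 - i := by
      intro h
      rw [Equiv.swap_apply_def]
      split_ifs <;> omega
    have : ¬ i < d → Equiv.swap 0 (d - 1) i = i := by
      intro h
      rw [Equiv.swap_apply_def]
      split_ifs <;> omega
    grind
  | succ j => simp [step, mem_swapStep, genPerm]

theorem permMap_apply {ι : Type} (σ : Equiv.Perm ι) (x : ι → ℝ) (i : ι) :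
    permMap σ x i = x (σ.symm i) := rfl

theorem permMap_mul {ι : Type} (σ τ : Equiv.Perm ι) :
    permMap (σ * τ) = permMap σ * permMap τ := rfl

theorem signMap_apply {ι : Type} (ε : ι → ℤˣ) (x : ι → ℝ) (i : ι) :
    signMap ε x i = (ε i : ℤ) * x i := by
  simp [signMap, Units.smul_def]

theorem genInfty_apply {d : ℕ} (hd : d = 1 ∨ d = 2) (n : ℕ) (x : ℕ → ℝ) (i : ℕ) :
    genInfty (specialRefl d) n x i =
      if n = 0 ∧ i < d then -x (genPerm d n i) else x (genPerm d n i) := by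
  cases n with
  | zero =>
    rcases hd with rfl | rfl
    · simp only [genInfty, specialRefl, if_true, reflB, signMap_apply, genPerm]
      by_cases h : i = 0 <;> simp [h]
    · simp only [genInfty, specialRefl, reflD, genPerm]
      by_cases h : i < 2 <;> simp [h, ↓signMap_apply, permMap_apply, -Order.lt_two_iff]
  | succ j => simp [genInfty, permMap_apply, genPerm]

/-! ### The limiting groups as groups of signed permutations -/

section Limit

theorem permMap_swap_mem (s₀ : Equiv.Perm (ℕ → ℝ)) (i n : ℕ) :
    permMap (Equiv.swap i (i + n)) ∈ Subgroup.closure (Set.range (genInfty s₀)) := by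
  induction n with
  | zero =>
    rw [add_zero, Equiv.swap_self]
    exact one_mem _
  | succ n ih =>
    have hgen : permMap (Equiv.swap (i + n) (i + n + 1)) ∈
        Subgroup.closure (Set.range (genInfty s₀)) :=
      Subgroup.subset_closure ⟨i + n + 1, rfl⟩
    rcases Nat.eq_zero_or_pos n with rfl | hn
    · exact hgen
    · have : Equiv.swap i (i + (n + 1)) = Equiv.swap (i + n) (i + n + 1) *
          Equiv.swap i (i + n) * Equiv.swap (i + n) (i + n + 1) := by
        ext a
        simp only [Equiv.Perm.mul_apply, Equiv.swap_apply_def]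
        split_ifs <;> omega
      rw [this, permMap_mul, permMap_mul]
      exact mul_mem (mul_mem hgen ih) hgen

theorem permMap_mem_closure (s₀ : Equiv.Perm (ℕ → ℝ)) {σ : Equiv.Perm ℕ}
    (hσ : {i | σ i ≠ i}.Finite) :
    permMap σ ∈ Subgroup.closure (Set.range (genInfty s₀)) := by
  have : σ ∈ Subgroup.closure {τ : Equiv.Perm ℕ | τ.IsSwap} := mem_closure_isSwap'.2 hσ
  clear hσ
  induction this using Subgroup.closure_induction with
  | mem τ hτ =>
    obtain ⟨i, j, -, rfl⟩ := hτ
    rcases le_total i j with h | h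
    · obtain ⟨n, rfl⟩ := Nat.exists_eq_add_of_le h
      exact permMap_swap_mem _ _ _
    · obtain ⟨n, rfl⟩ := Nat.exists_eq_add_of_le h
      rw [Equiv.swap_comm]
      exact permMap_swap_mem _ _ _
  | one => exact one_mem _
  | mul τ τ' _ _ h h' => exact mul_mem h h'
  | inv τ _ h => exact inv_mem h

theorem finite_mul {σ τ : Equiv.Perm ℕ} (hσ : {i | σ i ≠ i}.Finite) (hτ : {i | τ i ≠ i}.Finite) :
    {i | (σ * τ) i ≠ i}.Finite := by
  refine (hσ.union hτ).subset fun i hi => ?_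
  by_contra h
  simp only [Set.mem_union, Set.mem_ofPred_eq, not_or, not_not] at h
  exact hi (by rw [Equiv.Perm.mul_apply, h.2, h.1])

theorem finite_inv {σ : Equiv.Perm ℕ} (hσ : {i | σ i ≠ i}.Finite) : {i | σ⁻¹ i ≠ i}.Finite := by
  convert hσ using 3 with i
  rw [not_iff_not, Equiv.Perm.inv_eq_iff_eq, eq_comm]

theorem finite_swap (a b : ℕ) : {i | Equiv.swap a b i ≠ i}.Finite := by
  refine (Set.toFinite {a, b}).subset fun i hi => ?_
  by_contra h
  simp only [Set.mem_insert_iff, Set.mem_singleton_iff, not_or] at h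
  exact hi (Equiv.swap_apply_of_ne_of_ne h.1 h.2)

theorem finite_genPerm (d n : ℕ) : {i | genPerm d n i ≠ i}.Finite := by
  cases n <;> exact finite_swap _ _

variable {d : ℕ} {r : ℝ}

/-- Finite permutations are products of transpositions, and conjugation by adjacent transpositions
reduces each of these to an adjacent one. -/
theorem limit_W_eq :
    (limitDatum d r).W = Subgroup.closure (Set.range (limitDatum d r).gen) := by
  refine le_antisymm (sup_le ((Subgroup.closure_le _).2 ?_) ((Subgroup.closure_le _).2 ?_))
    ((Subgroup.closure_le _).2 ?_)
  · rintro _ ⟨σ, hσ, rfl⟩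
    exact permMap_mem_closure _ hσ
  · rintro _ rfl
    exact Subgroup.subset_closure ⟨0, rfl⟩
  · rintro _ ⟨n, rfl⟩
    cases n with
    | zero => exact (le_sup_right : _ ≤ (limitDatum d r).W) (Subgroup.subset_closure rfl)
    | succ j =>
      exact (le_sup_left : _ ≤ (limitDatum d r).W)
        (Subgroup.subset_closure ⟨_, finite_swap j (j + 1), rfl⟩)

theorem limit_gen_mem (n : ℕ) : (limitDatum d r).gen n ∈ (limitDatum d r).W := by
  rw [limit_W_eq]
  exact Subgroup.subset_closure ⟨n, rfl⟩

theorem limit_gen_apply (hd : d = 1 ∨ d = 2) (n : ℕ) (x : ℕ → ℝ) (i : ℕ) :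
    (limitDatum d r).gen n x i =
      if n = 0 ∧ i < d then -x (genPerm d n i) else x (genPerm d n i) :=
  genInfty_apply hd n x i

theorem genPerm_genPerm (d n i : ℕ) : genPerm d n (genPerm d n i) = i := by
  cases n <;> simp [genPerm]

theorem genPerm_zero_lt {i : ℕ} : genPerm d 0 i < d ↔ i < d := by
  simp only [genPerm, Equiv.swap_apply_def]
  split_ifs <;> omega

theorem limit_gen_inv (hd : d = 1 ∨ d = 2) (n : ℕ) :
    ((limitDatum d r).gen n)⁻¹ = (limitDatum d r).gen n := by
  refine inv_eq_of_mul_eq_one_left (Equiv.ext fun x => funext fun i => ?_)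
  rw [Equiv.Perm.mul_apply, limit_gen_apply hd, limit_gen_apply hd, genPerm_genPerm]
  by_cases hn : n = 0
  · subst hn
    simp only [genPerm_zero_lt]
    split_ifs <;> simp
  · simp [hn]

theorem limit_exists_word (hd : d = 1 ∨ d = 2) {w : Equiv.Perm (ℕ → ℝ)}
    (hw : w ∈ (limitDatum d r).W) : ∃ l : List ℕ, (l.map (limitDatum d r).gen).prod = w := by
  rw [limit_W_eq] at hw
  induction hw using Subgroup.closure_induction_left with
  | one => exact ⟨[], rfl⟩
  | mul_left x hx y _ ih =>
    obtain ⟨n, rfl⟩ := hx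
    obtain ⟨l, rfl⟩ := ih
    exact ⟨n :: l, by simp⟩
  | inv_mul_cancel x hx y _ ih =>
    obtain ⟨n, rfl⟩ := hx
    obtain ⟨l, rfl⟩ := ih
    exact ⟨n :: l, by simp [limit_gen_inv hd]⟩

/-- `w` permutes the coordinates by `σ⁻¹` and then changes the signs in `A`. -/
def SignedPerm (A : Finset ℕ) (σ : Equiv.Perm ℕ) (w : Equiv.Perm (ℕ → ℝ)) : Prop :=
  ∀ x i, w x i = if i ∈ A then -x (σ i) else x (σ i)

/-- Prefixing a letter acts on the sign set by `step`, which raises the weight by at most one. The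
weight bound is the lower bound for coset lengths. -/
theorem limit_word_signedPerm (hd : d = 1 ∨ d = 2) (l : List ℕ) :
    ∃ (A : Finset ℕ) (σ : Equiv.Perm ℕ), d ∣ A.card ∧ {i | σ i ≠ i}.Finite ∧
      weight d A ≤ l.length ∧ SignedPerm A σ (l.map (limitDatum d r).gen).prod := by
  induction l with
  | nil => exact ⟨∅, 1, by simp, by simp, by simp [weight], fun x i => by simp⟩
  | cons n l ih =>
    obtain ⟨A, σ, hA, hσ, hl, h⟩ := ih
    refine ⟨step d n A, σ * genPerm d n, dvd_card_step n hA, finite_mul hσ (finite_genPerm d n),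
      (weight_step_le hd n A).trans (by simpa using hl), fun x i => ?_⟩
    rw [List.map_cons, List.prod_cons, Equiv.Perm.mul_apply, limit_gen_apply hd, h,
      Equiv.Perm.mul_apply]
    have := mem_step hd (n := n) (i := i) (A := A)
    grind

theorem limit_signedPerm (hd : d = 1 ∨ d = 2) {w : Equiv.Perm (ℕ → ℝ)}
    (hw : w ∈ (limitDatum d r).W) : ∃ (A : Finset ℕ) (σ : Equiv.Perm ℕ), d ∣ A.card ∧
      {i | σ i ≠ i}.Finite ∧ SignedPerm A σ w := by
  obtain ⟨l, rfl⟩ := limit_exists_word hd hw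
  obtain ⟨A, σ, hA, hσ, -, h⟩ := limit_word_signedPerm (r := r) hd l
  exact ⟨A, σ, hA, hσ, h⟩

/-- The vector with entries `-1` in `A` and `1` elsewhere. -/
def signVec (A : Finset ℕ) : ℕ → ℝ := fun i => if i ∈ A then -1 else 1

theorem signVec_injective : Function.Injective signVec := by
  intro A B h
  ext i
  have := congrFun h i
  simp only [signVec] at this
  by_cases hA : i ∈ A <;> by_cases hB : i ∈ B <;> simp only [hA, hB] at this ⊢ <;> norm_num at this

theorem SignedPerm.apply_signVec {A : Finset ℕ} {σ : Equiv.Perm ℕ} {w : Equiv.Perm (ℕ → ℝ)}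
    (h : SignedPerm A σ w) : w (signVec ∅) = signVec A := by
  funext i
  rw [h]
  simp [signVec]

theorem limit_gen_signVec (hd : d = 1 ∨ d = 2) (n : ℕ) (A : Finset ℕ) :
    (limitDatum d r).gen n (signVec A) = signVec (step d n A) := by
  funext i
  rw [limit_gen_apply hd, signVec, signVec]
  have := mem_step hd (n := n) (i := i) (A := A)
  grind

/-- The vector `(1, 1, …)` has stabilizer `S_∞` in `W` and its orbit consists of sign vectors, so a
coset is recorded by its set of negative signs. -/
theorem limit_realization (hd : d = 1 ∨ d = 2) {k : ℕ} (hk : d ≤ k) :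
    ∃ f : Model d k → Equiv.Perm (ℕ → ℝ) ⧸ (limitDatum d r).U,
      Realization (limitDatum d r).gen (limitDatum d r).U (fun i : Fin k => (i : ℕ))
        (Model.step hd hk) (fun x => weight d x.1) f ∧
      ∀ w ∈ (limitDatum d r).W, ∀ x : Model d k, w (signVec ∅) = signVec x.1 →
        (w : Equiv.Perm (ℕ → ℝ) ⧸ (limitDatum d r).U) = f x := by
  refine exists_realization (x₀ := Model.base d k) (P := fun x => signVec x.1) limit_gen_mem
    (fun _ _ h => h) (fun i j h => ⟨⟨i, h.trans_lt j.2⟩, rfl⟩)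
    (fun x y h => Subtype.ext (signVec_injective h)) (fun i x => limit_gen_signVec hd _ _)
    ?_ ?_ ?_ (by simp [weight, Model.base]) ?_ (fun i x => Subtype.ext (step_step hd _ _))
    (fun i x => weight_step_le hd _ _)
  · intro u hu
    induction hu using Subgroup.closure_induction with
    | mem u hu =>
      obtain ⟨σ, -, rfl⟩ := hu
      funext i
      simp [permMap_apply, signVec, Model.base]
    | one => rfl
    | mul u v _ _ h h' => rw [Equiv.Perm.mul_apply, h', h]
    | inv u _ h => rw [Equiv.Perm.inv_eq_iff_eq, h]
  · intro w hw hfix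
    obtain ⟨A, σ, -, hσ, h⟩ := limit_signedPerm hd hw
    have hA : A = ∅ := signVec_injective (h.apply_signVec.symm.trans hfix)
    subst hA
    refine Subgroup.subset_closure ⟨σ⁻¹, finite_inv hσ, Equiv.ext fun x => funext fun i => ?_⟩
    rw [h, permMap_apply]
    simp [Equiv.Perm.inv_def]
  · intro l x hl
    obtain ⟨A, σ, -, -, hA, h⟩ := limit_word_signedPerm (r := r) hd l
    have : A = x.1 := signVec_injective (h.apply_signVec.symm.trans hl)
    exact this ▸ hA
  · intro x hx
    obtain ⟨i, hi, h⟩ := exists_weight_step_lt hd x.2.1 x.2.2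
      (fun h => hx (Subtype.ext h))
    exact ⟨⟨i, hi⟩, h⟩

theorem limit_exists_word_signVec (hd : d = 1 ∨ d = 2) {A : Finset ℕ} (hA : d ∣ A.card) :
    ∃ w ∈ (limitDatum d r).W, w (signVec ∅) = signVec A := by
  obtain ⟨k, hk, hAk⟩ : ∃ k, d ≤ k ∧ A ⊆ Finset.range k := by
    refine ⟨max d (A.sup id + 1), le_max_left _ _, fun a ha => Finset.mem_range.2 ?_⟩
    exact lt_max_of_lt_right (Nat.lt_succ_of_le (Finset.le_sup (f := id) ha))
  obtain ⟨l, -, hl⟩ := exists_word_of_descent (t := Model.step hd hk)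
    (wt := fun x => weight d x.1) (x₀ := Model.base d k) (by simp [weight, Model.base])
    (fun x hx => by
      obtain ⟨i, hi, h⟩ := exists_weight_step_lt hd x.2.1 x.2.2 (fun h => hx (Subtype.ext h))
      exact ⟨⟨i, hi⟩, h⟩)
    (fun i x => Subtype.ext (step_step hd _ _)) (fun i x => weight_step_le hd _ _) ⟨A, hAk, hA⟩
  refine ⟨((l.map (fun i : Fin k => (i : ℕ))).map (limitDatum d r).gen).prod,
    Subgroup.list_prod_mem _ (by simpa using fun i _ => limit_gen_mem _), ?_⟩
  have := word_apply (s := (limitDatum d r).gen) (t := Model.step hd hk) (e := fun i : Fin k => (i : ℕ))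
    (P := fun x : Model d k => signVec x.1) (fun i x => limit_gen_signVec hd _ _) l
    (Model.base d k)
  rw [hl] at this
  exact this

/-- Some element of `W` has sign set `A`; it differs from `w` by a finite permutation on the right.
-/
theorem limit_mem_of_signedPerm (hd : d = 1 ∨ d = 2) {A : Finset ℕ} {σ : Equiv.Perm ℕ}
    {w : Equiv.Perm (ℕ → ℝ)} (hA : d ∣ A.card) (hσ : {i | σ i ≠ i}.Finite)
    (hw : SignedPerm A σ w) : w ∈ (limitDatum d r).W := by
  obtain ⟨v, hv, hvA⟩ := limit_exists_word_signVec (r := r) hd hA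
  obtain ⟨B, τ, -, hτ, h⟩ := limit_signedPerm hd hv
  have hB : B = A := signVec_injective (h.apply_signVec.symm.trans hvA)
  subst hB
  have : w = v * permMap (τ * σ⁻¹) := by
    refine Equiv.ext fun x => funext fun i => ?_
    rw [Equiv.Perm.mul_apply, hw, h, permMap_apply]
    simp [Equiv.Perm.mul_def, Equiv.Perm.inv_def]
  rw [this]
  exact mul_mem hv ((le_sup_left : _ ≤ (limitDatum d r).W)
    (Subgroup.subset_closure ⟨_, finite_mul hτ (finite_inv hσ), rfl⟩))

/-- The signed permutation given by `A` and `σ`. -/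
def signedPermMap (A : Finset ℕ) (σ : Equiv.Perm ℕ) : Equiv.Perm (ℕ → ℝ) :=
  signMap (fun i => if i ∈ A then -1 else 1) * permMap σ⁻¹

theorem signedPermMap_spec (A : Finset ℕ) (σ : Equiv.Perm ℕ) :
    SignedPerm A σ (signedPermMap A σ) := by
  intro x i
  rw [signedPermMap, Equiv.Perm.mul_apply, signMap_apply, permMap_apply]
  by_cases h : i ∈ A <;> simp [h, Equiv.Perm.inv_def]

end Limit

/-! ### The affine groups -/

section Affine

variable {d m ℓ : ℕ} {r : ℝ}

theorem affineReflection_single (a : Fin m) (c : ℝ) (x : Fin m → ℝ) (i : Fin m) :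
    affineReflection (Pi.single a 1) c x i = if i = a then 2 * c - x a else x i := by
  simp only [affineReflection, Function.Involutive.coe_toPerm, Pi.sub_apply, Pi.smul_apply,
    single_dotProduct, Pi.single_eq_same, one_mul, smul_eq_mul, div_one]
  by_cases h : i = a
  · subst h
    simp
    ring
  · simp [h]

theorem units_mul_self (s : ℤˣ) : ((s : ℤ) : ℝ) * (s : ℤ) = 1 := by
  rcases Int.units_eq_one_or s with rfl | rfl <;> simp

theorem affineReflection_single_add {a b : Fin m} (hab : a ≠ b) (s : ℤˣ) (c : ℝ) (x : Fin m → ℝ)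
    (i : Fin m) :
    affineReflection (Pi.single a 1 + Pi.single b ((s : ℤ) : ℝ)) c x i =
      if i = a then c - (s : ℤ) * x b else if i = b then (s : ℤ) * (c - x a) else x i := by
  have hs := units_mul_self s
  simp only [affineReflection, Function.Involutive.coe_toPerm, Pi.sub_apply, Pi.smul_apply,
    add_dotProduct, single_dotProduct, Pi.add_apply, Pi.single_eq_same, one_mul, smul_eq_mul,
    Pi.single_eq_of_ne hab, Pi.single_eq_of_ne hab.symm, add_zero, zero_add, hs]
  by_cases h : i = a
  · subst h
    simp [hab]
    ring
  · by_cases h' : i = b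
    · subst h'
      simp [h]
      linear_combination (-x i) * hs
    · simp [h, h']

theorem simpleRoot_eq_add {n : ℕ} (h : n + 1 < m) :
    simpleRoot m (n + 1) =
      Pi.single ⟨n, by omega⟩ 1 + Pi.single ⟨n + 1, h⟩ (((-1 : ℤˣ) : ℤ) : ℝ) := by
  funext j
  simp only [simpleRoot, Pi.add_apply, Pi.single_apply, Fin.ext_iff]
  split_ifs <;> first | omega | simp

theorem simpleRoot_last {n : ℕ} (h : n + 1 = m) :
    simpleRoot m m = Pi.single ⟨n, by omega⟩ 1 := by
  funext j
  have := j.2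
  simp only [simpleRoot, Pi.single_apply, Fin.ext_iff]
  split_ifs <;> first | omega | simp

/-- The limiting formula with `-x` replaced by reflection in `ℓ / d`. The generator `n = m` is
excluded because it has no limiting counterpart. -/
theorem affine_gen_apply (hd : d = 1 ∨ d = 2) (hdm : d ≤ m) {n : Fin (m + 1)} (hn : n.val < m)
    (x : Fin m → ℝ) {i j : Fin m} (hij : (j : ℕ) = genPerm d n i) :
    (affineDatum d m ℓ r).gen n x i =
      if n.val = 0 ∧ i.val < d then 2 * (ℓ / d : ℝ) - x j else x j := by
  obtain ⟨n, hn'⟩ := n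
  simp only at hn hij
  cases n with
  | zero =>
    simp only [affineDatum, if_true, true_and]
    rcases hd with rfl | rfl
    · have : (fun j : Fin m => if j.val < 1 then (1 : ℝ) else 0) = Pi.single ⟨0, hdm⟩ 1 := by
        funext j
        simp [Pi.single_apply, Fin.ext_iff]
      rw [this, affineReflection_single]
      have hji : j = i := Fin.ext (by simpa [genPerm] using hij)
      subst hji
      by_cases h : j = ⟨0, hdm⟩
      · simp [h]
      · have h' : ¬ j.val < 1 := fun h0 => h (Fin.ext (by simpa using h0))
        rw [if_neg h, if_neg h']
    · have h01 : (⟨0, by omega⟩ : Fin m) ≠ ⟨1, hdm⟩ := by simp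
      have : (fun j : Fin m => if j.val < 2 then (1 : ℝ) else 0) =
          Pi.single ⟨0, by omega⟩ 1 + Pi.single ⟨1, hdm⟩ (((1 : ℤˣ) : ℤ) : ℝ) := by
        funext j
        simp only [Pi.add_apply, Pi.single_apply, Fin.ext_iff]
        split_ifs <;> first | omega | simp
      rw [this, affineReflection_single_add h01]
      simp only [genPerm, Equiv.swap_apply_def] at hij
      have hj : j = if i.val = 0 then ⟨1, hdm⟩ else if i.val = 1 then ⟨0, by omega⟩ else i := by
        ext
        rw [hij]
        split_ifs <;> simp_all
      simp only [Fin.ext_iff]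
      rw [hj]
      have h2 : (2 : ℝ) * ((ℓ : ℝ) / ((2 : ℕ) : ℝ)) = ℓ := by push_cast; ring
      rw [h2]
      by_cases h0 : i.val = 0
      · simp [h0]
      · by_cases h1 : i.val = 1
        · simp [h1]
        · rw [if_neg h0, if_neg h1, if_neg (by omega), if_neg h0, if_neg h1]
  | succ n =>
    have hab : (⟨n, by omega⟩ : Fin m) ≠ ⟨n + 1, hn⟩ := by simp
    simp only [affineDatum, Nat.add_eq_zero_iff, one_ne_zero, and_false, if_false, false_and]
    rw [simpleRoot_eq_add hn, affineReflection_single_add hab]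
    simp only [genPerm, Equiv.swap_apply_def] at hij
    have hj : j = if i.val = n then ⟨n + 1, hn⟩ else if i.val = n + 1 then ⟨n, by omega⟩
        else i := by
      ext
      rw [hij]
      split_ifs <;> simp_all
    simp only [Fin.ext_iff]
    rw [hj]
    split_ifs <;> simp

theorem affine_gen_last_apply {n : Fin (m + 1)} (hn : n.val = m) (hm : 0 < m)
    (x : Fin m → ℝ) (i : Fin m) :
    (affineDatum d m ℓ r).gen n x i = if i.val + 1 = m then -x i else x i := by
  obtain ⟨k, rfl⟩ := Nat.exists_eq_add_of_le' hm
  simp only [affineDatum, hn, if_neg hm.ne']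
  rw [simpleRoot_last (n := k) rfl, affineReflection_single]
  by_cases h : i.val = k
  · have hi : i = ⟨k, by omega⟩ := Fin.ext h
    rw [if_pos hi, if_pos (by omega), ← hi]
    simp
  · rw [if_neg (by simpa [Fin.ext_iff] using h), if_neg (by omega)]

/-- `w` is a signed permutation followed by the translation by `p z`, where `d` divides the sum
of the entries of `z`. -/
def AffinePerm (d : ℕ) (p : ℝ) (σ : Equiv.Perm (Fin m)) (ε : Fin m → ℤˣ) (z : Fin m → ℤ)
    (w : Equiv.Perm (Fin m → ℝ)) : Prop :=
  (d : ℤ) ∣ ∑ i, z i ∧ ∀ x i, w x i = (ε i : ℤ) * x (σ i) + p * z i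

/-- Sign changes preserve the parity of every entry. -/
theorem dvd_sum_units_mul (hd : d = 1 ∨ d = 2) (σ : Equiv.Perm (Fin m)) (ε : Fin m → ℤˣ)
    {z : Fin m → ℤ} (hz : (d : ℤ) ∣ ∑ i, z i) : (d : ℤ) ∣ ∑ i, (ε i : ℤ) * z (σ i) := by
  have h : ∑ i, (ε i : ℤ) * z (σ i) = ∑ i, z i + ∑ i, ((ε i : ℤ) - 1) * z (σ i) := by
    rw [← Equiv.sum_comp σ z, ← Finset.sum_add_distrib]
    exact Finset.sum_congr rfl fun i _ => by ring
  rw [h]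
  refine dvd_add hz (Finset.dvd_sum fun i _ => dvd_mul_of_dvd_left ?_ _)
  rcases hd with rfl | rfl
  · exact one_dvd _
  · rcases Int.units_eq_one_or (ε i) with h | h <;> simp [h]

/-- The group of all affine signed permutations with `d` dividing the sum of the translation
entries. -/
def affinePermGroup (m : ℕ) (hd : d = 1 ∨ d = 2) (p : ℝ) : Subgroup (Equiv.Perm (Fin m → ℝ)) where
  carrier := {w | ∃ σ ε z, AffinePerm d p σ ε z w}
  one_mem' := ⟨1, 1, 0, by simp, fun x i => by simp⟩
  mul_mem' := by
    rintro v w ⟨σ, ε, z, hz, hv⟩ ⟨τ, η, y, hy, hw⟩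
    refine ⟨τ * σ, fun i => ε i * η (σ i), fun i => ε i * y (σ i) + z i, ?_, fun x i => ?_⟩
    · rw [Finset.sum_add_distrib]
      exact dvd_add (dvd_sum_units_mul hd σ ε hy) hz
    · rw [Equiv.Perm.mul_apply, hv, hw, Equiv.Perm.mul_apply]
      push_cast
      ring
  inv_mem' := by
    rintro w ⟨σ, ε, z, hz, hw⟩
    refine ⟨σ⁻¹, fun i => ε (σ⁻¹ i), fun i => -((ε (σ⁻¹ i) : ℤ) * z (σ⁻¹ i)), ?_, fun x i => ?_⟩
    · rw [Finset.sum_neg_distrib, dvd_neg]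
      exact dvd_sum_units_mul hd σ⁻¹ (fun i => ε (σ⁻¹ i)) hz
    · have h := hw (w⁻¹ x) (σ⁻¹ i)
      rw [← Equiv.Perm.mul_apply, mul_inv_cancel, Equiv.Perm.one_apply, ← Equiv.Perm.mul_apply,
        mul_inv_cancel, Equiv.Perm.one_apply] at h
      rw [h]
      push_cast
      linear_combination -(w⁻¹ x i) * units_mul_self (ε (σ⁻¹ i))

/-- With period `p = 2ℓ/d`, both lattices give translations by `p z` with `d ∣ ∑ z`: no condition
for `d = 1`, an even sum for `d = 2`. -/
theorem coLattice_translations (hd : d = 1 ∨ d = 2) {t : Equiv.Perm (Fin m → ℝ)} :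
    (∃ v ∈ coLattice d m, t = Equiv.addLeft ((ℓ : ℝ) • v)) ↔
      ∃ z : Fin m → ℤ, (d : ℤ) ∣ ∑ i, z i ∧ ∀ x i, t x i = x i + 2 * (ℓ / d : ℝ) * z i := by
  rcases hd with rfl | rfl
  · constructor
    · rintro ⟨v, hv, rfl⟩
      simp only [coLattice, if_true, latticeC] at hv
      obtain ⟨z, rfl⟩ := hv
      refine ⟨z, by simp, fun x i => ?_⟩
      simp
      ring
    · rintro ⟨z, -, h⟩
      refine ⟨fun i => 2 * z i, ⟨z, rfl⟩, Equiv.ext fun x => funext fun i => ?_⟩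
      rw [h]
      simp
      ring
  · constructor
    · rintro ⟨v, hv, rfl⟩
      obtain ⟨z, hz, rfl⟩ := hv
      refine ⟨z, even_iff_two_dvd.1 hz, fun x i => ?_⟩
      simp
      ring
    · rintro ⟨z, hz, h⟩
      refine ⟨fun i => z i, ⟨z, even_iff_two_dvd.2 hz, rfl⟩, Equiv.ext fun x => funext fun i => ?_⟩
      rw [h]
      simp
      ring

theorem affine_mem_iff (hd : d = 1 ∨ d = 2) {w : Equiv.Perm (Fin m → ℝ)} :
    w ∈ (affineDatum d m ℓ r).W ↔ ∃ σ ε z, AffinePerm d (2 * (ℓ / d : ℝ)) σ ε z w := by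
  constructor
  · intro hw
    suffices h : (affineDatum d m ℓ r).W ≤ affinePermGroup m hd (2 * (ℓ / d : ℝ)) from h hw
    refine sup_le ((Subgroup.closure_le _).2 ?_) ((Subgroup.closure_le _).2 ?_)
    · rintro _ (⟨σ, rfl⟩ | ⟨ε, rfl⟩)
      · exact ⟨σ⁻¹, 1, 0, by simp, fun x i => by simp [permMap_apply, Equiv.Perm.inv_def]⟩
      · exact ⟨1, ε, 0, by simp, fun x i => by simp [signMap_apply]⟩
    · intro t ht
      obtain ⟨z, hz, h⟩ := (coLattice_translations hd).1 ht
      exact ⟨1, 1, z, hz, fun x i => by simp [h]⟩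
  · rintro ⟨σ, ε, z, hz, h⟩
    have ht := (coLattice_translations (ℓ := ℓ) hd
      (t := Equiv.addLeft fun i => 2 * (ℓ / d : ℝ) * z i)).2
      ⟨z, hz, fun x i => by simp [add_comm]⟩
    have : w = (Equiv.addLeft fun i => 2 * (ℓ / d : ℝ) * z i) *
        (signMap ε * permMap σ⁻¹) := by
      refine Equiv.ext fun x => funext fun i => ?_
      simp [h, signMap_apply, permMap_apply, Equiv.Perm.inv_def, add_comm]
    rw [this]
    refine mul_mem ((le_sup_right : _ ≤ (affineDatum d m ℓ r).W) (Subgroup.subset_closure ht))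
      ((le_sup_left : _ ≤ (affineDatum d m ℓ r).W) (mul_mem
        (Subgroup.subset_closure (Or.inr ⟨ε, rfl⟩))
        (Subgroup.subset_closure (Or.inl ⟨σ⁻¹, rfl⟩))))

/-- The permutation `genPerm d n`, restricted to the first `m` coordinates. -/
def genPermFin (hd : d = 1 ∨ d = 2) (hdm : d ≤ m) {n : ℕ} (hn : n < m) : Equiv.Perm (Fin m) :=
  Function.Involutive.toPerm
    (fun i => ⟨genPerm d n i, genPerm_lt (by omega) hdm hn i.2⟩)
    fun i => Fin.ext (genPerm_genPerm d n i)

theorem sum_indicator_lt (hdm : d ≤ m) : ∑ i : Fin m, (if i.val < d then (1 : ℤ) else 0) = d := by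
  rw [Fin.sum_univ_eq_sum_range (fun i => if i < d then (1 : ℤ) else 0) m, Finset.sum_boole]
  have : (Finset.range m).filter (· < d) = Finset.range d := by
    ext a
    simp only [Finset.mem_filter, Finset.mem_range]
    omega
  rw [this, Finset.card_range]

theorem affine_gen_mem (hd : d = 1 ∨ d = 2) (hdm : d ≤ m) (n : Fin (m + 1)) :
    (affineDatum d m ℓ r).gen n ∈ (affineDatum d m ℓ r).W := by
  refine (affine_mem_iff hd).2 ?_
  rcases (Nat.lt_succ_iff.1 n.2).lt_or_eq with hn | hn
  · refine ⟨genPermFin hd hdm hn, fun i => if n.val = 0 ∧ i.val < d then -1 else 1,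
      fun i => if n.val = 0 ∧ i.val < d then 1 else 0, ?_, fun x i => ?_⟩
    · by_cases h : n.val = 0
      · simp only [h, true_and, sum_indicator_lt hdm, dvd_refl]
      · simp [h]
    · rw [affine_gen_apply hd hdm hn x (j := genPermFin hd hdm hn i) rfl]
      by_cases h : n.val = 0 ∧ i.val < d
      · simp only [if_pos h]
        push_cast
        ring
      · simp only [if_neg h]
        push_cast
        ring
  · refine ⟨1, fun i => if i.val + 1 = m then -1 else 1, 0, by simp, fun x i => ?_⟩
    rw [affine_gen_last_apply hn (by omega)]
    by_cases h : i.val + 1 = m <;> simp [h]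

/-- The vector with entries `p` in `A` and `0` elsewhere. -/
def vertexVec (m : ℕ) (p : ℝ) (A : Finset ℕ) : Fin m → ℝ := fun i => if i.val ∈ A then p else 0

theorem affine_gen_vertexVec (hd : d = 1 ∨ d = 2) (hdm : d ≤ m) {n : Fin (m + 1)} (hn : n.val < m)
    (A : Finset ℕ) :
    (affineDatum d m ℓ r).gen n (vertexVec m (2 * (ℓ / d : ℝ)) A) =
      vertexVec m (2 * (ℓ / d : ℝ)) (step d n A) := by
  funext i
  rw [affine_gen_apply hd hdm hn _ (j := genPermFin hd hdm hn i) rfl]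
  have h1 := mem_step hd (n := n) (i := i) (A := A)
  have h2 : (genPermFin hd hdm hn i : ℕ) = genPerm d n i := rfl
  simp only [vertexVec, h2]
  split_ifs <;> simp_all

/-- The set of indices of the odd entries. -/
def oddSet (z : Fin m → ℤ) : Finset ℕ :=
  (Finset.univ.filter fun i => Odd (z i)).map Fin.valEmbedding

theorem mem_oddSet {z : Fin m → ℤ} {a : ℕ} : a ∈ oddSet z ↔ ∃ h : a < m, Odd (z ⟨a, h⟩) := by
  simp only [oddSet, Finset.mem_map, Finset.mem_filter, Finset.mem_univ, true_and,
    Fin.valEmbedding_apply]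
  constructor
  · rintro ⟨i, hi, rfl⟩
    exact ⟨i.2, hi⟩
  · rintro ⟨h, hz⟩
    exact ⟨⟨a, h⟩, hz, rfl⟩

theorem oddSet_step (hd : d = 1 ∨ d = 2) (hdm : d ≤ m) {n : ℕ} (hn : n < m) (z : Fin m → ℤ) :
    oddSet (fun i => if n = 0 ∧ i.val < d then 1 - z (genPermFin hd hdm hn i)
      else z (genPermFin hd hdm hn i)) = step d n (oddSet z) := by
  ext a
  rw [mem_step hd]
  by_cases ha : a < m
  · have hg : genPerm d n a < m := genPerm_lt (by omega) hdm hn ha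
    have h2 : genPermFin hd hdm hn ⟨a, ha⟩ = ⟨genPerm d n a, hg⟩ := rfl
    have h3 : ∀ t : ℤ, Odd (1 - t) ↔ ¬ Odd t := fun t => by
      rw [Int.odd_sub]
      simp
    simp only [mem_oddSet, ha, hg, h2, exists_true_left]
    split_ifs
    · exact h3 _
    · exact Iff.rfl
  · have hg : ¬ genPerm d n a < m := fun h => ha (by
      simpa [genPerm_genPerm] using genPerm_lt (d := d) (n := n) (by omega) hdm hn h)
    have had : ¬ a < d := by omega
    simp [mem_oddSet, ha, hg, had]

/-- Only parities matter: `z ↦ 1 - z` flips them, so the first `m` generators act on the odd set by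
`step`, while the last generator changes a sign and leaves the odd set unchanged. Hence using the
last generator never helps to reach a coset of the model sooner. -/
theorem affine_word_zero (hd : d = 1 ∨ d = 2) (hdm : d ≤ m) (l : List (Fin (m + 1))) :
    ∃ z : Fin m → ℤ, (l.map (affineDatum d m ℓ r).gen).prod 0 =
      (fun i => 2 * (ℓ / d : ℝ) * z i) ∧ weight d (oddSet z) ≤ l.length := by
  induction l with
  | nil =>
    refine ⟨0, by funext i; simp, ?_⟩
    have : oddSet (0 : Fin m → ℤ) = ∅ := by
      ext a
      simp [mem_oddSet]
    simp [this, weight]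
  | cons n l ih =>
    obtain ⟨z, hz, hl⟩ := ih
    rw [List.map_cons, List.prod_cons, Equiv.Perm.mul_apply, hz, List.length_cons]
    rcases (Nat.lt_succ_iff.1 n.2).lt_or_eq with hn | hn
    · refine ⟨_, ?_, (oddSet_step hd hdm hn z).symm ▸ (weight_step_le hd n _).trans (by simpa)⟩
      funext i
      rw [affine_gen_apply hd hdm hn _ (j := genPermFin hd hdm hn i) rfl]
      split_ifs
      · push_cast
        ring
      · rfl
    · refine ⟨fun i => if i.val + 1 = m then -z i else z i, ?_, ?_⟩
      · funext i
        rw [affine_gen_last_apply hn (by omega)]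
        by_cases h : i.val + 1 = m <;> simp [h]
      · have : oddSet (fun i => if i.val + 1 = m then -z i else z i) = oddSet z := by
          ext a
          simp only [mem_oddSet]
          refine exists_congr fun h => ?_
          split_ifs
          · exact odd_neg
          · exact Iff.rfl
        rw [this]
        omega

/-- The origin has stabilizer `U` in the affine group, so cosets are points of its orbit; the set
`A` stands for the point with entries `2ℓ/d` on `A` and `0` elsewhere. -/
theorem affine_realization (hd : d = 1 ∨ d = 2) (hℓ : 0 < ℓ) {k : ℕ} (hk : d ≤ k) (hkm : k ≤ m) :
    ∃ f : Model d k → Equiv.Perm (Fin m → ℝ) ⧸ (affineDatum d m ℓ r).U,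
      Realization (affineDatum d m ℓ r).gen (affineDatum d m ℓ r).U
        (Fin.castLE (hkm.trans (Nat.le_succ m))) (Model.step hd hk) (fun x => weight d x.1) f ∧
      ∀ w ∈ (affineDatum d m ℓ r).W, ∀ x : Model d k,
        w 0 = vertexVec m (2 * (ℓ / d : ℝ)) x.1 →
        (w : Equiv.Perm (Fin m → ℝ) ⧸ (affineDatum d m ℓ r).U) = f x := by
  have hp : 2 * (ℓ / d : ℝ) ≠ 0 := by
    have : (d : ℝ) ≠ 0 := by rcases hd with rfl | rfl <;> simp
    have : (ℓ : ℝ) ≠ 0 := by exact_mod_cast hℓ.ne'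
    positivity
  have hbase : vertexVec m (2 * (ℓ / d : ℝ)) (Model.base d k).1 = 0 := by
    funext i
    simp [vertexVec, Model.base]
  rw [← hbase]
  refine exists_realization (x₀ := Model.base d k)
    (P := fun x => vertexVec m (2 * (ℓ / d : ℝ)) x.1) (affine_gen_mem hd (hk.trans hkm))
    (fun _ _ h => h) (fun i j h => ⟨⟨i, lt_of_le_of_lt (Fin.le_def.1 h) j.2⟩, rfl⟩)
    (fun x y h => Subtype.ext ?_)
    (fun i x => affine_gen_vertexVec hd (hk.trans hkm) (n := Fin.castLE _ i)
      (i.2.trans_le hkm) x.1)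
    ?_ ?_ ?_ (by simp [weight, Model.base]) ?_ (fun i x => Subtype.ext (step_step hd _ _))
    (fun i x => weight_step_le hd _ _)
  · ext a
    by_cases ha : a < m
    · have := congrFun h ⟨a, ha⟩
      simp only [vertexVec] at this
      split_ifs at this <;> simp_all
    · have h1 : a ∉ x.1 := fun h => ha ((Finset.mem_range.1 (x.2.1 h)).trans_le hkm)
      have h2 : a ∉ y.1 := fun h => ha ((Finset.mem_range.1 (y.2.1 h)).trans_le hkm)
      simp [h1, h2]
  · intro u hu
    rw [hbase]
    induction hu using Subgroup.closure_induction with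
    | mem u hu =>
      rcases hu with ⟨σ, rfl⟩ | ⟨ε, rfl⟩
      · rfl
      · funext i
        simp [signMap_apply]
    | one => rfl
    | mul u v _ _ h h' => rw [Equiv.Perm.mul_apply, h', h]
    | inv u _ h => rw [Equiv.Perm.inv_eq_iff_eq, h]
  · intro w hw hfix
    rw [hbase] at hfix
    obtain ⟨σ, ε, z, -, h⟩ := (affine_mem_iff hd).1 hw
    have hz : ∀ i, (z i : ℝ) = 0 := fun i => by
      have := congrFun hfix i
      rw [h] at this
      simpa [hp] using this
    have : w = signMap ε * permMap σ⁻¹ := by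
      refine Equiv.ext fun x => funext fun i => ?_
      simp [h, signMap_apply, permMap_apply, Equiv.Perm.inv_def, hz]
    rw [this]
    exact mul_mem (Subgroup.subset_closure (Or.inr ⟨ε, rfl⟩))
        (Subgroup.subset_closure (Or.inl ⟨σ⁻¹, rfl⟩))
  · intro l x hl
    obtain ⟨z, hz, hlen⟩ := affine_word_zero (ℓ := ℓ) (r := r) hd (hk.trans hkm) l
    rw [hbase, hz] at hl
    have : oddSet z = x.1 := by
      ext a
      by_cases ha : a < m
      · have := congrFun hl ⟨a, ha⟩
        simp only [vertexVec] at this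
        simp only [mem_oddSet, ha, exists_true_left]
        split_ifs at this with hax
        · have : z ⟨a, ha⟩ = 1 := by exact_mod_cast mul_left_cancel₀ hp (this.trans (mul_one _).symm)
          simp [this, hax]
        · have : z ⟨a, ha⟩ = 0 := by
            exact_mod_cast (mul_eq_zero.1 this).resolve_left hp
          simp [this, hax]
      · have h1 : a ∉ x.1 := fun h => ha ((Finset.mem_range.1 (x.2.1 h)).trans_le hkm)
        simp [mem_oddSet, ha, h1]
    exact this ▸ hlen
  · intro x hx
    obtain ⟨i, hi, h⟩ := exists_weight_step_lt hd x.2.1 x.2.2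
      (fun h => hx (Subtype.ext h))
    exact ⟨⟨i, hi⟩, h⟩

/-- The affine embedding that intertwines the limiting action with the affine action. -/
def embed (m : ℕ) (c : ℝ) (x : ℕ → ℝ) : Fin m → ℝ := fun i => x i + c

theorem affine_gen_embed (hd : d = 1 ∨ d = 2) (hdm : d ≤ m) {n : Fin (m + 1)} (hn : n.val < m)
    (x : ℕ → ℝ) {r' : ℝ} :
    (affineDatum d m ℓ r).gen n (embed m (ℓ / d) x) =
      embed m (ℓ / d) ((limitDatum d r').gen n x) := by
  funext i
  rw [affine_gen_apply hd hdm hn _ (j := genPermFin hd hdm hn i) rfl]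
  simp only [embed, limit_gen_apply hd]
  have h2 : (genPermFin hd hdm hn i : ℕ) = genPerm d n i := rfl
  rw [h2]
  split_ifs <;> ring

theorem affine_word_embed (hd : d = 1 ∨ d = 2) (hdm : d ≤ m) {r' : ℝ} {l : List ℕ}
    (hl : ∀ n ∈ l, n < m) : ∃ w ∈ (affineDatum d m ℓ r).W, ∀ x,
      w (embed m (ℓ / d) x) = embed m (ℓ / d) ((l.map (limitDatum d r').gen).prod x) := by
  induction l with
  | nil => exact ⟨1, one_mem _, fun x => rfl⟩
  | cons n l ih =>
    obtain ⟨w, hw, h⟩ := ih fun a ha => hl a (List.mem_cons_of_mem _ ha)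
    have hn : n < m := hl n List.mem_cons_self
    refine ⟨(affineDatum d m ℓ r).gen ⟨n, hn.trans (Nat.lt_succ_self m)⟩ * w,
      mul_mem (affine_gen_mem hd hdm _) hw, fun x => ?_⟩
    rw [Equiv.Perm.mul_apply, h, affine_gen_embed hd hdm hn (r' := r'), List.map_cons, List.prod_cons,
      Equiv.Perm.mul_apply]

end Affine

/-! ### Uniqueness -/

namespace ReflectionDatum

variable {ι κ : Type} (R : ReflectionDatum ι κ)

/-- An element of `W` that maps a point of `dom` into `dom` is trivial. -/
def FreeOnDom : Prop := ∀ x ∈ R.dom, ∀ w ∈ R.W, R.dot w x ∈ R.dom → w = 1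

variable {R}

theorem dot_mul (v w : Equiv.Perm (ι → ℝ)) (x : ι → ℝ) : R.dot (v * w) x = R.dot v (R.dot w x) := by
  simp [dot]

theorem dot_one (x : ι → ℝ) : R.dot 1 x = x := by
  simp [dot]

/-- A stabilizer of `x`, conjugated by `w`, fixes a point of `dom`. -/
theorem FreeOnDom.admissible (h : R.FreeOnDom) {x : ι → ℝ} {w : Equiv.Perm (ι → ℝ)} (hw : w ∈ R.W)
    (hx : R.dot w⁻¹ x ∈ R.dom) : R.Admissible x := by
  refine ⟨fun v hv hvx => ?_, w, hw, hx⟩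
  have := h _ hx (w⁻¹ * v * w) (mul_mem (mul_mem (inv_mem hw) hv) hw) (by
    rw [dot_mul, dot_mul, ← dot_mul w, mul_inv_cancel, dot_one, hvx]
    exact hx)
  rw [mul_assoc, inv_mul_eq_one] at this
  exact (mul_eq_right.1 this.symm)

theorem FreeOnDom.eq_of_dom (h : R.FreeOnDom) {x : ι → ℝ} {v w : Equiv.Perm (ι → ℝ)} (hv : v ∈ R.W)
    (hw : w ∈ R.W) (hvx : R.dot v⁻¹ x ∈ R.dom) (hwx : R.dot w⁻¹ x ∈ R.dom) : v = w := by
  have := h _ hvx (w⁻¹ * v) (mul_mem (inv_mem hw) hv) (by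
    rw [← dot_mul, mul_assoc, mul_inv_cancel, mul_one]
    exact hwx)
  rw [inv_mul_eq_one] at this
  exact this.symm

variable [LinearOrder κ] [WellFoundedLT κ]

/-- Freeness identifies the pair selected by `choose` with the given one. -/
theorem FreeOnDom.coeff_eq (h : R.FreeOnDom) {x y : ι → ℝ} {w u : Equiv.Perm (ι → ℝ)}
    (hw : w ∈ R.W) (hx : R.dot w⁻¹ x ∈ R.dom) (hu : u ∈ R.W) (hy : R.dot u (R.dot w⁻¹ x) = y) :
    R.coeff x y = LaurentPolynomial.eval₂ (RingHom.id ℤ) 1 (parabolicKL R.gen R.U u w) := by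
  have hex : ∃ p : Equiv.Perm (ι → ℝ) × Equiv.Perm (ι → ℝ), p.1 ∈ R.W ∧ p.2 ∈ R.W ∧
      R.dot p.1⁻¹ x ∈ R.dom ∧ R.dot p.2 (R.dot p.1⁻¹ x) = y := ⟨(w, u), hw, hu, hx, hy⟩
  rw [coeff, dif_pos hex]
  obtain ⟨h1, h2, h3, h4⟩ := hex.choose_spec
  have e1 := h.eq_of_dom h1 hw h3 hx
  rw [e1] at h4
  have e2 := h _ hx (u⁻¹ * hex.choose.2) (mul_mem (inv_mem hu) h2) (by
    rw [dot_mul, h4, ← hy, ← dot_mul, inv_mul_cancel, dot_one]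
    exact hx)
  rw [inv_mul_eq_one] at e2
  rw [e1, ← e2]

theorem FreeOnDom.coeff_eq_zero (h : R.FreeOnDom) {x y : ι → ℝ} {w : Equiv.Perm (ι → ℝ)}
    (hw : w ∈ R.W) (hx : R.dot w⁻¹ x ∈ R.dom) (hy : ∀ u ∈ R.W, R.dot u (R.dot w⁻¹ x) ≠ y) :
    R.coeff x y = 0 := by
  refine dif_neg ?_
  rintro ⟨p, h1, h2, h3, h4⟩
  rw [h.eq_of_dom h1 hw h3 hx] at h4
  exact hy _ h2 h4

end ReflectionDatum

theorem perm_eq_one_of_strictMono {α : Type} [LinearOrder α] [WellFoundedLT α] {σ : Equiv.Perm α}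
    (h : StrictMono σ) : σ = 1 := by
  have : h.orderIsoOfSurjective σ σ.surjective = OrderIso.refl α := Subsingleton.elim _ _
  ext a
  exact congrArg (fun f : α ≃o α => f a) this

variable {d m ℓ : ℕ} {r : ℝ}

theorem seq_add_rho_strictAnti (lam : YoungDiagram) :
    StrictAnti (seq lam + (limitDatum d r).rho) := by
  intro i j hij
  have h1 : (lam.rowLen j : ℝ) ≤ lam.rowLen i := by exact_mod_cast lam.rowLen_anti i j hij.le
  have h2 : (i : ℝ) < j := by exact_mod_cast hij
  simp only [Pi.add_apply, seq, limitDatum]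
  linarith

theorem limit_mem_dom {nu : YoungDiagram} : seq nu ∈ (limitDatum d r).dom ↔
    (seq nu + (limitDatum d r).rho) 0 + (seq nu + (limitDatum d r).rho) (d - 1) < 0 := by
  have : seq nu ∈ (limitDatum d r).dom ↔
      (nu.rowLen 0 + nu.rowLen (d - 1) + 2 * r < ((d - 1 : ℕ) : ℝ)) := by
    constructor
    · rintro ⟨nu', h, h'⟩
      have h0 := congrFun h' 0
      have h1 := congrFun h' (d - 1)
      simp only [seq] at h0 h1
      rwa [h0, h1]
    · exact fun h => ⟨nu, h, rfl⟩
  rw [this]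
  simp only [Pi.add_apply, seq, limitDatum, Nat.cast_zero]
  constructor <;> intro h <;> linarith

/-- On the domain the absolute values `|y i|` strictly increase, so the underlying permutation is
trivial. From index `d - 1` on the entries are negative in both vectors, so fewer than `d` signs can
change, and divisibility leaves none. -/
theorem limit_freeOnDom (hd : d = 1 ∨ d = 2) : (limitDatum d r).FreeOnDom := by
  rintro _ ⟨nu, hnu, rfl⟩ w hw ⟨nu', hnu', hdot⟩
  have hnu := limit_mem_dom.1 (show seq nu ∈ (limitDatum d r).dom from ⟨nu, hnu, rfl⟩)
  have hnu' := limit_mem_dom.1 (show seq nu' ∈ (limitDatum d r).dom from ⟨nu', hnu', rfl⟩)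
  have hwy : w (seq nu + (limitDatum d r).rho) = seq nu' + (limitDatum d r).rho := by
    rw [← hdot, ReflectionDatum.dot, sub_add_cancel]
  have hy := seq_add_rho_strictAnti (d := d) (r := r) nu
  have hy' := seq_add_rho_strictAnti (d := d) (r := r) nu'
  generalize seq nu + (limitDatum d r).rho = y at *
  generalize seq nu' + (limitDatum d r).rho = y' at *
  obtain ⟨A, σ, hA, hσ, h⟩ := limit_signedPerm hd hw
  have habs : ∀ y : ℕ → ℝ, StrictAnti y → y 0 + y (d - 1) < 0 → StrictMono fun i => |y i| := by
    intro y hy h0 i j hij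
    have h1 : y j < y i := hy hij
    have h2 : y i ≤ y 0 := hy.antitone (Nat.zero_le i)
    have h3 : y j ≤ y (d - 1) := hy.antitone (by omega)
    show |y i| < |y j|
    rw [abs_of_neg (a := y j) (by linarith), abs_lt]
    constructor <;> linarith
  have hσ1 : σ = 1 := by
    have hab : ∀ i, |y' i| = |y (σ i)| := fun i => by
      rw [← hwy, h]
      split_ifs <;> simp
    refine perm_eq_one_of_strictMono fun i j hij => ?_
    have := habs y' hy' hnu' hij
    simp only [hab] at this
    exact (habs y hy hnu).lt_iff_lt.1 this
  subst hσ1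
  have hA0 : A = ∅ := by
    have key : ∀ i ∈ A, i < d - 1 := by
      intro i hi
      by_contra hlt
      have h1 : y' i = - y i := by rw [← hwy, h, if_pos hi]; rfl
      have h2 : y i ≤ y (d - 1) := hy.antitone (by omega)
      have h3 : y' i ≤ y' (d - 1) := hy'.antitone (by omega)
      have h4 : y (d - 1) ≤ y 0 := hy.antitone (by omega)
      have h5 : y' (d - 1) ≤ y' 0 := hy'.antitone (by omega)
      linarith
    have hsub : A ⊆ Finset.range (d - 1) := fun i hi => Finset.mem_range.2 (key i hi)
    have hle := Finset.card_le_card hsub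
    rw [Finset.card_range] at hle
    exact Finset.card_eq_zero.1 (Nat.eq_zero_of_dvd_of_lt hA (by omega))
  subst hA0
  refine Equiv.ext fun x => funext fun i => ?_
  rw [h]
  simp

/-! ### Freeness of the affine action on the alcove. -/

section Affine

/-- A map `a ↦ ± a + p z` that relates two numbers between `0` and `p` is the identity or the
reflection in `p / 2`. -/
theorem units_int_eq_of_mem_Ioo {p a b : ℝ} (ha : 0 < a) (ha' : a < p) (hb : 0 < b) (hb' : b < p)
    {ε : ℤˣ} {z : ℤ} (h : b = (ε : ℤ) * a + p * z) : (ε = 1 ∧ z = 0) ∨ (ε = -1 ∧ z = 1) := by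
  have hp : 0 < p := ha.trans ha'
  rcases Int.units_eq_one_or ε with rfl | rfl
  · left
    refine ⟨rfl, ?_⟩
    simp only [Units.val_one, Int.cast_one, one_mul] at h
    have h1 : (z : ℝ) < 1 := by
      by_contra hz
      nlinarith [not_lt.1 hz]
    have h2 : (-1 : ℝ) < z := by
      by_contra hz
      nlinarith [not_lt.1 hz]
    have h3 : z < 1 := by exact_mod_cast h1
    have h4 : -1 < z := by exact_mod_cast h2
    omega
  · right
    refine ⟨rfl, ?_⟩
    simp only [Units.val_neg, Units.val_one, Int.cast_neg, Int.cast_one] at h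
    have h1 : (z : ℝ) < 2 := by
      by_contra hz
      nlinarith [not_lt.1 hz]
    have h2 : (0 : ℝ) < z := by
      by_contra hz
      nlinarith [not_lt.1 hz]
    have h3 : z < 2 := by exact_mod_cast h1
    have h4 : 0 < z := by exact_mod_cast h2
    omega

/-- The difference is `2 sin(π(a+b)/p) sin(π(a-b)/p)` with both arguments in `(0, π)`. Here `a` may
exceed `p / 2`, as the first coordinate of an alcove point can when `d = 2`. -/
theorem cos_lt_cos_of_add_lt {p a b : ℝ} (hb : 0 < b) (hab : b < a) (h : a + b < p) :
    Real.cos (2 * Real.pi / p * a) < Real.cos (2 * Real.pi / p * b) := by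
  have ha : 0 < a := hb.trans hab
  have hp : 0 < p := by linarith
  have hπ := Real.pi_pos
  rw [← sub_neg, Real.cos_sub_cos]
  have h1 : 0 < Real.sin ((2 * Real.pi / p * a + 2 * Real.pi / p * b) / 2) := by
    have e : (2 * Real.pi / p * a + 2 * Real.pi / p * b) / 2 = Real.pi * ((a + b) / p) := by ring
    rw [e]
    refine Real.sin_pos_of_pos_of_lt_pi (by positivity) ?_
    exact mul_lt_of_lt_one_right hπ ((div_lt_one hp).2 h)
  have h2 : 0 < Real.sin ((2 * Real.pi / p * a - 2 * Real.pi / p * b) / 2) := by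
    have e : (2 * Real.pi / p * a - 2 * Real.pi / p * b) / 2 = Real.pi * ((a - b) / p) := by ring
    rw [e]
    have : 0 < a - b := sub_pos.2 hab
    refine Real.sin_pos_of_pos_of_lt_pi (by positivity) ?_
    exact mul_lt_of_lt_one_right hπ ((div_lt_one hp).2 (by linarith))
  have := mul_pos h1 h2
  linarith

/-- The fundamental alcove. -/
def Alcove (d m : ℕ) (p : ℝ) (y : Fin m → ℝ) : Prop :=
  (∀ i j, i < j → y j < y i) ∧ (∀ i, 0 < y i) ∧
    ∀ i j : Fin m, i.val = 0 → j.val = d - 1 → y i + y j < p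

theorem affine_mem_dom {x : Fin m → ℝ} : x ∈ (affineDatum d m ℓ r).dom ↔
    Alcove d m (2 * (ℓ / d : ℝ)) (x + (affineDatum d m ℓ r).rho) := Iff.rfl

theorem Alcove.antitone {p : ℝ} {y : Fin m → ℝ} (h : Alcove d m p y) : Antitone y := fun i j hij =>
  hij.eq_or_lt.elim (fun e => e ▸ le_rfl) fun e => (h.1 i j e).le

theorem Alcove.add_lt {p : ℝ} {y : Fin m → ℝ}
    (h : Alcove d m p y) (i : Fin m) {j : Fin m} (hj : d - 1 ≤ j.val) : y i + y j < p := by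
  have h0 := h.2.2 ⟨0, by omega⟩ ⟨d - 1, by omega⟩ rfl rfl
  have h1 : y i ≤ y ⟨0, by omega⟩ := h.antitone (Fin.le_def.2 (Nat.zero_le _))
  have h2 : y j ≤ y ⟨d - 1, by omega⟩ := h.antitone (Fin.le_def.2 hj)
  linarith

theorem Alcove.lt (hd : d = 1 ∨ d = 2) (hdm : d ≤ m) {p : ℝ} {y : Fin m → ℝ}
    (h : Alcove d m p y) (i : Fin m) : y i < p := by
  have h1 := h.add_lt i (j := ⟨d - 1, by omega⟩) le_rfl
  have h2 := h.2.1 ⟨d - 1, by omega⟩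
  linarith

/-- The function `cos(2πa/p)` is invariant under `a ↦ ±a + pz` and strictly monotone along the
coordinates of an alcove point, so the permutation is trivial. Each coordinate is then fixed or
reflected in `p / 2`; the alcove inequalities exclude reflection from index `d - 1` on, and for `d =
2` reflecting coordinate `0` alone violates parity. -/
theorem affine_eq_one (hd : d = 1 ∨ d = 2) (hdm : d ≤ m) {p : ℝ} {y y' : Fin m → ℝ}
    (hy : Alcove d m p y) (hy' : Alcove d m p y') {σ : Equiv.Perm (Fin m)} {ε : Fin m → ℤˣ}
    {z : Fin m → ℤ} {w : Equiv.Perm (Fin m → ℝ)} (hw : AffinePerm d p σ ε z w) (hwy : w y = y') :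
    w = 1 := by
  obtain ⟨hz, h⟩ := hw
  have hcos : ∀ y, Alcove d m p y →
      StrictMono fun i => Real.cos (2 * Real.pi / p * y i) := by
    intro y hy i j hij
    exact cos_lt_cos_of_add_lt (hy.2.1 j) (hy.1 i j hij) (hy.add_lt i (by omega))
  have hp : p ≠ 0 := by
    have h1 := hy.2.1 ⟨0, by omega⟩
    have h2 := hy.lt hd hdm ⟨0, by omega⟩
    linarith
  have hyi : ∀ i, y' i = (ε i : ℤ) * y (σ i) + p * z i := fun i => by rw [← hwy, h]
  have hσ : σ = 1 := by
    have e : ∀ i, Real.cos (2 * Real.pi / p * y' i) = Real.cos (2 * Real.pi / p * y (σ i)) := by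
      intro i
      have e1 : 2 * Real.pi / p * y' i =
          (ε i : ℤ) * (2 * Real.pi / p * y (σ i)) + z i * (2 * Real.pi) := by
        rw [hyi]
        field_simp
      rw [e1, Real.cos_add_int_mul_two_pi]
      rcases Int.units_eq_one_or (ε i) with h | h <;> simp [h]
    refine perm_eq_one_of_strictMono fun i j hij => ?_
    have := hcos y' hy' hij
    simp only [e] at this
    exact (hcos y hy).lt_iff_lt.1 this
  subst hσ
  have key : ∀ i, (ε i = 1 ∧ z i = 0) ∨ (ε i = -1 ∧ z i = 1) := fun i =>
    units_int_eq_of_mem_Ioo (hy.2.1 i) (hy.lt hd hdm i) (hy'.2.1 i) (hy'.lt hd hdm i) (hyi i)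
  have hlow : ∀ i : Fin m, d - 1 ≤ i.val → z i = 0 := by
    intro i hi
    rcases key i with h | ⟨h1, h2⟩
    · exact h.2
    · have e := hyi i
      rw [h1, h2] at e
      have e1 := hy.add_lt i hi
      have e2 := hy'.add_lt i hi
      simp only [Units.val_neg, Units.val_one, Int.cast_neg, Int.cast_one,
        Equiv.Perm.one_apply] at e
      linarith
  have hz0 : ∀ i, z i = 0 := by
    intro i
    by_cases hi : d - 1 ≤ i.val
    · exact hlow i hi
    · have hd2 : d = 2 := by omega
      subst hd2
      rw [Finset.sum_eq_single i (fun j _ hj => hlow j (by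
        have := mt Fin.ext hj
        omega)) (by simp)] at hz
      rcases key i with h | h
      · exact h.2
      · rw [h.2] at hz
        norm_num at hz
  refine Equiv.ext fun x => funext fun i => ?_
  have hε : ε i = 1 := by
    rcases key i with h | h
    · exact h.1
    · have := hz0 i
      omega
  rw [h, hz0, hε]
  simp

theorem affine_freeOnDom (hd : d = 1 ∨ d = 2) (hdm : d ≤ m) :
    (affineDatum d m ℓ r).FreeOnDom := by
  intro x hx w hw hwx
  obtain ⟨σ, ε, z, h⟩ := (affine_mem_iff hd).1 hw
  rw [affine_mem_dom] at hx hwx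
  rw [ReflectionDatum.dot, sub_add_cancel] at hwx
  exact affine_eq_one hd hdm hx hwx h rfl

/-- An affine signed permutation that relates two vectors with entries between `0` and `p`
comes from the limiting group. -/
theorem exists_signedPerm_of_affinePerm {p : ℝ} {y y' : Fin m → ℝ}
    (hy : ∀ i, 0 < y i ∧ y i < p) (hy' : ∀ i, 0 < y' i ∧ y' i < p) {σ : Equiv.Perm (Fin m)}
    {ε : Fin m → ℤˣ} {z : Fin m → ℤ} {w : Equiv.Perm (Fin m → ℝ)} (hw : AffinePerm d p σ ε z w)
    (hwy : w y = y') : ∃ A : Finset ℕ, d ∣ A.card ∧ A ⊆ Finset.range m ∧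
      ∀ i : Fin m, y' i = if i.val ∈ A then p - y (σ i) else y (σ i) := by
  obtain ⟨hz, h⟩ := hw
  have key : ∀ i, (ε i = 1 ∧ z i = 0) ∨ (ε i = -1 ∧ z i = 1) := fun i =>
    units_int_eq_of_mem_Ioo (hy _).1 (hy _).2 (hy' i).1 (hy' i).2 (by rw [← hwy, h])
  have hodd : ∀ i : Fin m, i.val ∈ oddSet z ↔ z i = 1 := by
    intro i
    rw [mem_oddSet]
    rcases key i with h | h <;> simp [h.2]
  refine ⟨oddSet z, ?_, fun a ha => Finset.mem_range.2 (mem_oddSet.1 ha).1, fun i => ?_⟩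
  · have : ∑ i, z i = (oddSet z).card := by
      rw [oddSet, Finset.card_map, ← Finset.sum_boole]
      refine Finset.sum_congr rfl fun i _ => ?_
      rcases key i with h | h <;> simp [h.2]
    rw [this] at hz
    exact_mod_cast hz
  · rw [← hwy, h]
    simp only [hodd]
    rcases key i with h | h <;> simp [h]
    ring

end Affine

/-! ### Existence of a dominant point in the limiting orbit -/

theorem exists_youngDiagram_rowLen {f : ℕ → ℕ} (hf : Antitone f) {n : ℕ}
    (hn : ∀ i, n ≤ i → f i = 0) : ∃ nu : YoungDiagram, ∀ i, nu.rowLen i = f i := by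
  have hmem : ∀ c : ℕ × ℕ, c ∈ (Finset.range n ×ˢ Finset.range (f 0)).filter
      (fun c => c.2 < f c.1) ↔ c.2 < f c.1 := by
    intro c
    simp only [Finset.mem_filter, Finset.mem_product, Finset.mem_range, and_iff_right_iff_imp]
    intro h
    refine ⟨?_, h.trans_le (hf (Nat.zero_le _))⟩
    by_contra hc
    have := hn c.1 (by omega)
    omega
  refine ⟨⟨(Finset.range n ×ˢ Finset.range (f 0)).filter fun c => c.2 < f c.1, ?_⟩, fun i => ?_⟩
  · intro c c' hc h
    have h' := (hmem c).1 h
    refine (hmem c').2 ?_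
    have h1 : c'.2 ≤ c.2 := hc.2
    have h2 : f c.1 ≤ f c'.1 := hf hc.1
    omega
  · refine eq_of_forall_lt_iff fun j => ?_
    rw [← YoungDiagram.mem_iff_lt_rowLen]
    exact hmem (i, j)

theorem rowLen_eq_zero {lam : YoungDiagram} {i : ℕ} (h : lam.colLen 0 ≤ i) : lam.rowLen i = 0 := by
  by_contra h0
  have h1 : (i, 0) ∈ lam := YoungDiagram.mem_iff_lt_rowLen.2 (Nat.pos_of_ne_zero h0)
  have := YoungDiagram.mem_iff_lt_colLen.1 h1
  omega

/-- The extension of a permutation of `{0, …, m - 1}` to `ℕ`. -/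
def extendPerm {m : ℕ} (σ : Equiv.Perm (Fin m)) : Equiv.Perm ℕ :=
  σ.extendDomain Fin.equivSubtype

theorem extendPerm_val {m : ℕ} (σ : Equiv.Perm (Fin m)) (i : Fin m) :
    extendPerm σ i = σ i :=
  Equiv.Perm.extendDomain_apply_image σ Fin.equivSubtype i

theorem extendPerm_of_le {m : ℕ} (σ : Equiv.Perm (Fin m)) {i : ℕ} (h : m ≤ i) :
    extendPerm σ i = i :=
  Equiv.Perm.extendDomain_apply_not_subtype _ _ (not_lt.2 h)

theorem finite_extendPerm {m : ℕ} (σ : Equiv.Perm (Fin m)) : {i | extendPerm σ i ≠ i}.Finite :=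
  (Set.finite_lt_nat m).subset fun i hi => by
    by_contra h
    exact hi (extendPerm_of_le σ (not_lt.1 h))

variable {d : ℕ} {r : ℝ}

theorem regular_eq_one {lam : YoungDiagram} (hd : d = 1 ∨ d = 2)
    (hreg : (limitDatum d r).Regular (seq lam)) {A : Finset ℕ} {σ : Equiv.Perm ℕ}
    (hA : d ∣ A.card) (hσ : {i | σ i ≠ i}.Finite)
    (h : ∀ i, (if i ∈ A then -(seq lam + (limitDatum d r).rho) (σ i)
      else (seq lam + (limitDatum d r).rho) (σ i)) = (seq lam + (limitDatum d r).rho) i) :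
    A = ∅ := by
  have hw := signedPermMap_spec A σ
  have h1 := hreg _ (limit_mem_of_signedPerm hd hA hσ hw) (by
    rw [ReflectionDatum.dot, sub_eq_iff_eq_add]
    funext i
    rw [hw, h])
  have h2 := hw.apply_signVec
  rw [h1] at h2
  exact signVec_injective (show signVec A = signVec ∅ from h2.symm)

/-- The shifted sequence strictly decreases, so a coincidence means `z i = -z j`; exchanging the two
entries and negating both would fix it. Two sign changes are allowed for either `d`. -/
theorem regular_abs_injective {lam : YoungDiagram} (hd : d = 1 ∨ d = 2)
    (hreg : (limitDatum d r).Regular (seq lam)) :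
    Function.Injective fun i => |(seq lam + (limitDatum d r).rho) i| := by
  intro i j hij
  by_contra hne
  have hanti := seq_add_rho_strictAnti (d := d) (r := r) lam
  have h := regular_eq_one (A := {i, j}) (σ := Equiv.swap i j) hd hreg
    (by rw [Finset.card_pair hne]; rcases hd with rfl | rfl <;> norm_num) (finite_swap i j)
  generalize seq lam + (limitDatum d r).rho = z at *
  have hz : z i = - z j := (abs_eq_abs.1 hij).resolve_left fun e => hne (hanti.injective e)
  refine Finset.insert_ne_empty _ _ (h fun a => ?_)
  by_cases hai : a = i
  · subst hai
    simp [hz]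
  · by_cases haj : a = j
    · subst haj
      simp [hz]
    · simp [hai, haj, Equiv.swap_apply_of_ne_of_ne hai haj]

/-- A single sign change belongs to the group only for `d = 1`; for `d = 2` an entry may vanish. -/
theorem regular_ne_zero {lam : YoungDiagram} (hd : d = 1)
    (hreg : (limitDatum d r).Regular (seq lam)) (i : ℕ) :
    (seq lam + (limitDatum d r).rho) i ≠ 0 := by
  intro h0
  have h := regular_eq_one (A := {i}) (σ := 1) (Or.inl hd) hreg
    (by simp [hd]) (by simp)
  refine Finset.singleton_ne_empty _ (h fun a => ?_)
  by_cases hai : a = i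
  · subst hai
    simp [h0]
  · simp [hai]

/-- For `d = 2` the sign at index `0` is left free by dominance, so parity can be corrected there.
-/
theorem exists_dvd_card (hd : d = 1 ∨ d = 2) (A : Finset ℕ) :
    ∃ B : Finset ℕ, d ∣ B.card ∧ ∀ i, d - 1 ≤ i → (i ∈ B ↔ i ∈ A) := by
  by_cases h : d ∣ A.card
  · exact ⟨A, h, fun i _ => Iff.rfl⟩
  · have hd2 : d = 2 := hd.resolve_left fun h1 => h (h1 ▸ one_dvd _)
    subst hd2
    by_cases h0 : 0 ∈ A
    · refine ⟨A.erase 0, ?_, fun i hi => ?_⟩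
      · have := Finset.card_erase_add_one h0
        omega
      · have : i ≠ 0 := by omega
        simp [this]
    · refine ⟨insert 0 A, ?_, fun i hi => ?_⟩
      · rw [Finset.card_insert_of_notMem h0]
        omega
      · have : i ≠ 0 := by omega
        simp [this]

theorem exists_sorting_perm {z : ℕ → ℝ} (hz : Function.Injective fun i => |z i|) {n : ℕ}
    (hn : ∀ i j, n ≤ j → i < j → |z i| < |z j|) :
    ∃ σ : Equiv.Perm ℕ, {i | σ i ≠ i}.Finite ∧ (∀ i, n ≤ i → σ i = i) ∧
      StrictMono fun i => |z (σ i)| := by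
  set f : Fin n → ℝ := fun i => |z i| with hf
  refine ⟨extendPerm (Tuple.sort f), finite_extendPerm _, fun i => extendPerm_of_le _, ?_⟩
  intro i j hij
  rcases lt_or_ge j n with hj | hj
  · have hmono : StrictMono (f ∘ Tuple.sort f) :=
      (Tuple.monotone_sort f).strictMono_of_injective
        fun a b h => (Tuple.sort f).injective (Fin.ext (hz h))
    have := @hmono ⟨i, hij.trans hj⟩ ⟨j, hj⟩ hij
    simp only [Function.comp_apply, hf] at this
    rwa [← extendPerm_val, ← extendPerm_val] at this
  · show |z (extendPerm (Tuple.sort f) i)| < |z (extendPerm (Tuple.sort f) j)|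
    rw [extendPerm_of_le _ hj]
    refine hn _ _ hj ?_
    rcases lt_or_ge i n with hi | hi
    · have := extendPerm_val (Tuple.sort f) ⟨i, hi⟩
      rw [this]
      exact (Fin.is_lt _).trans_le hj
    · rwa [extendPerm_of_le _ hi]

/-- Sort `z = λ + ρ` by absolute value and make every entry nonpositive, except that for `d = 2`
parity decides the first sign. The result strictly decreases; subtracting `ρ` leaves a
nonincreasing, eventually zero integer sequence, that is, a Young diagram. Integrality needs `2r ∈
ℤ` because of the sign changes. -/
theorem limit_exists_dom (hd : d = 1 ∨ d = 2) (hr : ∃ c : ℤ, 2 * r = c) {lam : YoungDiagram}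
    (hreg : (limitDatum d r).Regular (seq lam)) :
    ∃ w ∈ (limitDatum d r).W, ∃ nu : YoungDiagram,
      (limitDatum d r).dot w (seq lam) = seq nu ∧ seq nu ∈ (limitDatum d r).dom := by
  have hinj := regular_abs_injective hd hreg
  have hne := fun h => regular_ne_zero (d := d) h hreg
  have hanti := seq_add_rho_strictAnti (d := d) (r := r) lam
  have hzi : ∀ i, (seq lam + (limitDatum d r).rho) i = lam.rowLen i + (r - i) := fun i => rfl
  set z := seq lam + (limitDatum d r).rho with hzdef
  -- For `j ≥ n` the entry is `r - j < 0`, and it exceeds all earlier ones in absolute value, as `z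
  -- i ≤ λ₀ + r < j - r`.
  obtain ⟨n, hn⟩ : ∃ n : ℕ, d ≤ n ∧ lam.colLen 0 ≤ n ∧ (lam.rowLen 0 : ℝ) + 2 * |r| < n := by
    obtain ⟨n, hn⟩ := exists_nat_gt ((lam.rowLen 0 : ℝ) + 2 * |r|)
    refine ⟨max n (max d (lam.colLen 0)), by omega, by omega, hn.trans_le ?_⟩
    exact_mod_cast le_max_left _ _
  obtain ⟨hdn, hcol, hrow⟩ := hn
  have hr1 := le_abs_self r
  have hr2 := neg_abs_le r
  have hrow0 : (0 : ℝ) ≤ lam.rowLen 0 := Nat.cast_nonneg _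
  have hbig : ∀ i, n ≤ i → z i = r - i ∧ z i < 0 := by
    intro i hi
    have h1 : z i = r - i := by rw [hzi, rowLen_eq_zero (hcol.trans hi)]; simp
    have h2 : (n : ℝ) ≤ i := by exact_mod_cast hi
    have := abs_nonneg r
    exact ⟨h1, by rw [h1]; linarith⟩
  obtain ⟨σ, hσ, hσn, hmono⟩ := exists_sorting_perm hinj (n := n) (by
    intro i j hj hij
    obtain ⟨h1, h2⟩ := hbig j hj
    rw [abs_of_neg h2, abs_lt]
    have h3 := hanti hij
    have h4 : z i ≤ z 0 := hanti.antitone (Nat.zero_le i)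
    have h5 : z 0 = lam.rowLen 0 + r := by rw [hzi]; simp
    have h6 : (n : ℝ) ≤ j := by exact_mod_cast hj
    constructor <;> linarith)
  obtain ⟨A, hA, hAmem⟩ := exists_dvd_card hd ((Finset.range n).filter fun i => 0 < z (σ i))
  have hw := signedPermMap_spec A σ
  set w := signedPermMap A σ with hwdef
  have hwW : w ∈ (limitDatum d r).W := limit_mem_of_signedPerm hd hA hσ hw
  have hx1 : ∀ i, d - 1 ≤ i → w z i = -|z (σ i)| := by
    intro i hi
    rw [hw]
    have hmem := hAmem i hi
    simp only [Finset.mem_filter, Finset.mem_range] at hmem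
    split_ifs with h
    · rw [abs_of_pos (hmem.1 h).2]
    · have : z (σ i) ≤ 0 := by
        by_contra hpos
        have hni : n ≤ i := by
          by_contra hi'
          exact h (hmem.2 ⟨by omega, not_le.1 hpos⟩)
        rw [hσn i hni] at hpos
        exact hpos (hbig i hni).2.le
      rw [abs_of_nonpos this, neg_neg]
  have hx2 : ∀ i, |w z i| = |z (σ i)| := fun i => by
    rw [hw]
    split_ifs <;> simp
  have hxanti : StrictAnti (w z) := by
    intro i j hij
    have h1 := hx1 j (by omega)
    have h2 := neg_abs_le (w z i)
    have h3 := hmono hij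
    simp only at h3
    rw [hx2] at h2
    linarith
  have hx0 : w z 0 + w z (d - 1) < 0 := by
    have h1 := hx1 (d - 1) le_rfl
    have h2 := le_abs_self (w z 0)
    rw [hx2] at h2
    rcases hd with hd1 | hd2
    · have : 0 < |z (σ 0)| := abs_pos.2 (hne hd1 _)
      have h3 : d - 1 = 0 := by omega
      rw [h3] at h1 ⊢
      linarith
    · have h3 : (0 : ℕ) < d - 1 := by omega
      have h4 := hmono h3
      simp only at h4
      linarith
  obtain ⟨c, hc⟩ := hr
  have hint : ∀ i, ∃ g : ℤ, w z i = g + (r - i) := by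
    intro i
    rw [hw, hzi]
    split_ifs
    · refine ⟨-(lam.rowLen (σ i)) + (σ i) + i - c, ?_⟩
      push_cast
      linarith
    · refine ⟨lam.rowLen (σ i) - (σ i) + i, ?_⟩
      push_cast
      ring
  choose g hg using hint
  -- The entries of `w z` strictly drop while those of `ρ` drop by exactly `1`, so `g (i + 1) < g i
  -- + 1`.
  have hganti : Antitone g := antitone_nat_of_succ_le fun i => by
    have h1 := hxanti (Nat.lt_succ_self i)
    rw [hg, hg] at h1
    push_cast at h1
    have h2 : (g (i + 1) : ℝ) < g i + 1 := by
      have : ((i.succ : ℕ) : ℝ) = i + 1 := by push_cast; ring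
      linarith
    have h3 : g (i + 1) < g i + 1 := by exact_mod_cast h2
    omega
  have hgn : ∀ i, n ≤ i → g i = 0 := by
    intro i hi
    have h1 := hx1 i (by omega)
    obtain ⟨h2, h3⟩ := hbig i hi
    rw [hσn i hi, abs_of_neg h3, neg_neg, hg, h2] at h1
    have : (g i : ℝ) = 0 := by linarith
    exact_mod_cast this
  have hg0 : ∀ i, 0 ≤ g i := fun i => by
    rw [← hgn (max i n) (le_max_right _ _)]
    exact hganti (le_max_left _ _)
  obtain ⟨nu, hnu⟩ := exists_youngDiagram_rowLen (f := fun i => (g i).toNat)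
    (fun i j hij => Int.toNat_le_toNat (hganti hij)) (n := n) (fun i hi => by simp [hgn i hi])
  have hxnu : seq nu + (limitDatum d r).rho = w z := by
    funext i
    have h1 : ((nu.rowLen i : ℕ) : ℝ) = g i := by
      rw [hnu]
      have := Int.toNat_of_nonneg (hg0 i)
      exact_mod_cast this
    rw [hg, ← h1]
    rfl
  refine ⟨w, hwW, nu, ?_, ?_⟩
  · rw [ReflectionDatum.dot, sub_eq_iff_eq_add]
    exact hxnu.symm
  · rw [limit_mem_dom, hxnu]
    exact hx0

/-! ### Stabilization -/

variable {d m ℓ : ℕ} {r : ℝ}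

theorem limit_word_signVec (hd : d = 1 ∨ d = 2) {k : ℕ} (hk : d ≤ k) {l : List ℕ}
    (hl : ∀ n ∈ l, n < k) :
    ∃ x : Model d k, (l.map (limitDatum d r).gen).prod (signVec ∅) = signVec x.1 := by
  induction l with
  | nil => exact ⟨Model.base d k, rfl⟩
  | cons n l ih =>
    obtain ⟨x, hx⟩ := ih fun a ha => hl a (List.mem_cons_of_mem _ ha)
    refine ⟨Model.step hd hk ⟨n, hl n List.mem_cons_self⟩ x, ?_⟩
    rw [List.map_cons, List.prod_cons, Equiv.Perm.mul_apply, hx, limit_gen_signVec hd]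
    rfl

theorem limit_word_mem (l : List ℕ) :
    (l.map (limitDatum d r).gen).prod ∈ (limitDatum d r).W :=
  Subgroup.list_prod_mem _ (by simpa using fun i _ => limit_gen_mem i)

/-- The origin is the shift of the constant vector `-c`; changing the signs in `A` gives `c` there,
which the shift sends to `2c`. This matches the sign model with the vertex model. -/
theorem apply_zero_of_embed (hd : d = 1 ∨ d = 2) {w : Equiv.Perm (ℕ → ℝ)}
    (hw : w ∈ (limitDatum d r).W) {w' : Equiv.Perm (Fin m → ℝ)} {c : ℝ}
    (h : ∀ x, w' (embed m c x) = embed m c (w x)) {A : Finset ℕ} (hA : w (signVec ∅) = signVec A) :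
    w' 0 = vertexVec m (2 * c) A := by
  obtain ⟨B, σ, -, -, hB⟩ := limit_signedPerm hd hw
  have hBA : B = A := signVec_injective (hB.apply_signVec.symm.trans hA)
  subst hBA
  have h0 : embed m c (fun _ => -c) = 0 := by
    funext i
    simp [embed]
  rw [← h0, h]
  funext i
  rw [embed, hB, vertexVec]
  split_ifs <;> ring

/-- The parabolic Kazhdan-Lusztig polynomials of elements of the parabolic subgroup generated by
the first `k` generators agree in the limiting group and in the affine groups of rank `m ≥ k`. -/
theorem parabolicKL_eq (hd : d = 1 ∨ d = 2) (hℓ : 0 < ℓ) {k : ℕ} (hk : d ≤ k) (hkm : k ≤ m)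
    {l₁ l₂ : List ℕ} (hl₁ : ∀ n ∈ l₁, n < k) (hl₂ : ∀ n ∈ l₂, n < k)
    {w u : Equiv.Perm (Fin m → ℝ)} {r' : ℝ} (hw : w ∈ (affineDatum d m ℓ r').W)
    (hu : u ∈ (affineDatum d m ℓ r').W)
    (hwe : ∀ x, w (embed m (ℓ / d) x) = embed m (ℓ / d) ((l₁.map (limitDatum d r).gen).prod x))
    (hue : ∀ x, u (embed m (ℓ / d) x) = embed m (ℓ / d) ((l₂.map (limitDatum d r).gen).prod x)) :
    parabolicKL (affineDatum d m ℓ r').gen (affineDatum d m ℓ r').U u⁻¹ w⁻¹ =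
      parabolicKL (limitDatum d r).gen (limitDatum d r).U
        ((l₂.map (limitDatum d r).gen).prod)⁻¹ ((l₁.map (limitDatum d r).gen).prod)⁻¹ := by
  obtain ⟨x, hx⟩ := limit_word_signVec (r := r) hd hk hl₁
  obtain ⟨y, hy⟩ := limit_word_signVec (r := r) hd hk hl₂
  obtain ⟨f, hf, hfx⟩ := limit_realization (r := r) hd hk
  obtain ⟨f', hf', hfx'⟩ := affine_realization (r := r') hd hℓ hk hkm
  rw [parabolicKL, parabolicKL, inv_inv, inv_inv, inv_inv, inv_inv,
    hfx _ (limit_word_mem _) x hx, hfx _ (limit_word_mem _) y hy,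
    hfx' _ hw x (apply_zero_of_embed hd (limit_word_mem _) hwe hx),
    hfx' _ hu y (apply_zero_of_embed hd (limit_word_mem _) hue hy),
    hf.klElement_apply, hf'.klElement_apply]

theorem vec_add_rho (nu : YoungDiagram) :
    vec m nu + (affineDatum d m ℓ r).rho =
      embed m (ℓ / d) (seq nu + (limitDatum d r).rho) := by
  funext i
  simp only [vec, embed, seq, affineDatum, limitDatum, Pi.add_apply]
  ring

theorem dot_eq_iff {ι κ : Type} {R : ReflectionDatum ι κ} {w : Equiv.Perm (ι → ℝ)}
    {x y : ι → ℝ} : R.dot w x = y ↔ w (x + R.rho) = y + R.rho := by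
  rw [ReflectionDatum.dot, sub_eq_iff_eq_add]

theorem dot_vec {w : Equiv.Perm (ℕ → ℝ)} {w' : Equiv.Perm (Fin m → ℝ)}
    (h : ∀ x, w' (embed m (ℓ / d) x) = embed m (ℓ / d) (w x)) {lam nu : YoungDiagram}
    (hw : (limitDatum d r).dot w (seq lam) = seq nu) :
    (affineDatum d m ℓ r).dot w' (vec m lam) = vec m nu := by
  rw [dot_eq_iff] at hw ⊢
  rw [vec_add_rho, vec_add_rho, h, hw]

theorem embed_pos (hr : (m : ℝ) - 1 < r + ℓ / d) (nu : YoungDiagram) (i : Fin m) :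
    0 < embed m (ℓ / d) (seq nu + (limitDatum d r).rho) i := by
  have h1 : (i.val : ℝ) + 1 ≤ m := by exact_mod_cast i.2
  have h2 : (0 : ℝ) ≤ nu.rowLen i := Nat.cast_nonneg _
  simp only [embed, seq, limitDatum, Pi.add_apply]
  linarith

/-- The limiting wall is carried to the affine wall of the first generator. Positivity, the
remaining wall, follows from `hr`, since the last coordinate of `ρ` is `r + ℓ/d - (m - 1)`. -/
theorem vec_mem_dom (hr : (m : ℝ) - 1 < r + ℓ / d) {nu : YoungDiagram}
    (hnu : seq nu ∈ (limitDatum d r).dom) : vec m nu ∈ (affineDatum d m ℓ r).dom := by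
  rw [affine_mem_dom, vec_add_rho]
  rw [limit_mem_dom] at hnu
  refine ⟨fun i j hij => ?_, embed_pos hr nu, fun i j hi hj => ?_⟩
  · have := seq_add_rho_strictAnti (d := d) (r := r) nu (show i.val < j.val from hij)
    simpa only [embed, add_lt_add_iff_right] using this
  · rw [embed, embed, hi, hj]
    linarith

/-- For large rank, affine orbits of small weights come from orbits of the limiting group. -/
theorem exists_limit_of_affine (hd : d = 1 ∨ d = 2) (hdm : d ≤ m)
    (hr : (m : ℝ) - 1 < r + ℓ / d) {nu mu : YoungDiagram} (hnu : seq nu ∈ (limitDatum d r).dom)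
    (hnum : nu.colLen 0 ≤ m) (hmum : mu.colLen 0 ≤ m) (hmu : mu.rowLen 0 + 2 * r < m - 1)
    {u : Equiv.Perm (Fin m → ℝ)} (hu : u ∈ (affineDatum d m ℓ r).W)
    (h : (affineDatum d m ℓ r).dot u (vec m nu) = vec m mu) :
    ∃ v ∈ (limitDatum d r).W, (limitDatum d r).dot v (seq nu) = seq mu := by
  obtain ⟨σ, ε, z, huf⟩ := (affine_mem_iff hd).1 hu
  have halc := affine_mem_dom.1 (vec_mem_dom hr hnu)
  rw [dot_eq_iff, vec_add_rho, vec_add_rho] at h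
  rw [vec_add_rho] at halc
  -- `hr` and `hmu` together keep the entries of the shifted `μ` below `2ℓ/d`.
  obtain ⟨A, hA, hAm, hAi⟩ := exists_signedPerm_of_affinePerm
    (fun i => ⟨halc.2.1 i, halc.lt hd hdm i⟩) (fun i => ⟨embed_pos hr mu i, by
      have h1 : (mu.rowLen i : ℝ) ≤ mu.rowLen 0 := by
        exact_mod_cast mu.rowLen_anti 0 i (Nat.zero_le _)
      have h2 : (0 : ℝ) ≤ i.val := Nat.cast_nonneg _
      simp only [embed, seq, limitDatum, Pi.add_apply]
      linarith⟩) huf h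
  have hv := signedPermMap_spec A (extendPerm σ)
  refine ⟨_, limit_mem_of_signedPerm hd hA (finite_extendPerm σ) hv, ?_⟩
  rw [dot_eq_iff]
  funext i
  rw [hv]
  rcases lt_or_ge i m with hi | hi
  · have h1 := hAi ⟨i, hi⟩
    have h2 := extendPerm_val σ ⟨i, hi⟩
    simp only at h2
    simp only [embed] at h1
    rw [h2]
    split_ifs at h1 ⊢ <;> linarith
  -- Past `m` both diagrams have empty rows, so extending by the identity is correct.
  · have h1 : i ∉ A := fun h => by
      have := Finset.mem_range.1 (hAm h)
      omega
    rw [if_neg h1, extendPerm_of_le σ hi]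
    simp only [Pi.add_apply, seq, rowLen_eq_zero (hnum.trans hi), rowLen_eq_zero (hmum.trans hi)]

/-- The weight `ν` and the words taking `λ` and `μ` to it are chosen in the limiting group before
`m`; `m₀` only has to exceed their letters, the heights of `ν` and `μ`, and a bound on the first row
of `μ`. -/
theorem stabilization (hd : d = 1 ∨ d = 2) (hr : ∃ c : ℤ, 2 * r = c) (lam mu : YoungDiagram)
    (hreg : (limitDatum d r).Regular (seq lam)) :
    (limitDatum d r).Admissible (seq lam) ∧ ∃ m₀ : ℕ, ∀ m ≥ m₀, ∀ ℓ : ℕ, 0 < ℓ →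
      (m : ℝ) - 1 < r + ℓ / d → (affineDatum d m ℓ r).Admissible (vec m lam) ∧
      (affineDatum d m ℓ r).coeff (vec m lam) (vec m mu) =
        (limitDatum d r).coeff (seq lam) (seq mu) := by
  obtain ⟨w, hw, nu, hwnu, hnu⟩ := limit_exists_dom hd hr hreg
  have hwdom : (limitDatum d r).dot w⁻¹⁻¹ (seq lam) ∈ (limitDatum d r).dom := by
    rw [inv_inv, hwnu]
    exact hnu
  refine ⟨(limit_freeOnDom hd).admissible (inv_mem hw) hwdom, ?_⟩
  obtain ⟨l₁, rfl⟩ := limit_exists_word hd hw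
  obtain ⟨l₂, hl₂⟩ : ∃ l₂ : List ℕ,
      (∃ u ∈ (limitDatum d r).W, (limitDatum d r).dot u (seq nu) = seq mu) →
      (limitDatum d r).dot ((l₂.map (limitDatum d r).gen).prod) (seq mu) = seq nu := by
    by_cases h : ∃ u ∈ (limitDatum d r).W, (limitDatum d r).dot u (seq nu) = seq mu
    · obtain ⟨u, hu, hunu⟩ := h
      obtain ⟨l₂, hl₂⟩ := limit_exists_word hd (inv_mem hu)
      refine ⟨l₂, fun _ => ?_⟩
      rw [hl₂, ← hunu, ← ReflectionDatum.dot_mul, inv_mul_cancel, ReflectionDatum.dot_one]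
    · exact ⟨[], fun h' => absurd h' h⟩
  obtain ⟨n, hn⟩ := exists_nat_gt ((mu.rowLen 0 : ℝ) + 2 * r + 1)
  obtain ⟨k, hdk, hk₁, hk₂⟩ : ∃ k, d ≤ k ∧ (∀ n ∈ l₁, n < k) ∧ ∀ n ∈ l₂, n < k := by
    refine ⟨max d ((l₁ ++ l₂).sum + 1), le_max_left _ _, fun n hn => ?_, fun n hn => ?_⟩ <;>
    · refine lt_max_of_lt_right (Nat.lt_succ_of_le (List.le_sum_of_mem ?_))
      simp [hn]
  refine ⟨max k (max n (max (nu.colLen 0) (mu.colLen 0))), fun m hm ℓ hℓ hmr => ?_⟩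
  simp only [ge_iff_le, max_le_iff] at hm
  obtain ⟨hkm, hnm, hnum, hmum⟩ := hm
  have hdm : d ≤ m := hdk.trans hkm
  have hmu : mu.rowLen 0 + 2 * r < m - 1 := by
    have : (n : ℝ) ≤ m := by exact_mod_cast hnm
    linarith
  have hfree := affine_freeOnDom (ℓ := ℓ) (r := r) hd hdm
  obtain ⟨w', hw', hwe⟩ := affine_word_embed (ℓ := ℓ) (r := r) (r' := r) hd hdm
    fun n hn => (hk₁ n hn).trans_le hkm
  have hdot : (affineDatum d m ℓ r).dot w'⁻¹⁻¹ (vec m lam) = vec m nu := by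
    rw [inv_inv]
    exact dot_vec hwe hwnu
  have hdom : (affineDatum d m ℓ r).dot w'⁻¹⁻¹ (vec m lam) ∈ (affineDatum d m ℓ r).dom := by
    rw [hdot]
    exact vec_mem_dom hmr hnu
  refine ⟨hfree.admissible (inv_mem hw') hdom, ?_⟩
  by_cases h : ∃ u ∈ (limitDatum d r).W, (limitDatum d r).dot u (seq nu) = seq mu
  · have hmunu := hl₂ h
    obtain ⟨u', hu', hue⟩ := affine_word_embed (ℓ := ℓ) (r := r) (r' := r) hd hdm
      fun n hn => (hk₂ n hn).trans_le hkm
    rw [(limit_freeOnDom hd).coeff_eq (inv_mem hw) hwdom (inv_mem (limit_word_mem l₂)) (by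
        rw [inv_inv, hwnu, ← hmunu, ← ReflectionDatum.dot_mul, inv_mul_cancel,
          ReflectionDatum.dot_one]),
      hfree.coeff_eq (inv_mem hw') hdom (inv_mem hu') (by
        rw [hdot, ← dot_vec hue hmunu, ← ReflectionDatum.dot_mul, inv_mul_cancel,
          ReflectionDatum.dot_one]),
      parabolicKL_eq hd hℓ hdk hkm hk₁ hk₂ hw' hu' hwe hue]
  · rw [(limit_freeOnDom hd).coeff_eq_zero (inv_mem hw) hwdom (by
        intro u hu hunu
        rw [inv_inv, hwnu] at hunu
        exact h ⟨u, hu, hunu⟩),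
      hfree.coeff_eq_zero (inv_mem hw') hdom (by
        intro u hu hunu
        rw [hdot] at hunu
        exact h (exists_limit_of_affine hd hdm hmr hnu hnum hmum hmu hu hunu))]

/-! ### The four original data as instances of the common description. -/

theorem limitD_eq (N : ℕ) : limitD N = limitDatum 2 (-(N : ℝ) / 2) := by
  unfold limitD limitDatum specialRefl
  congr 1
  · funext i
    ring
  · ext x
    refine exists_congr fun nu => and_congr_left fun _ => ?_
    have : (nu.rowLen 0 : ℝ) + nu.rowLen (2 - 1) + 2 * (-(N : ℝ) / 2) < ((2 - 1 : ℕ) : ℝ) ↔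
        ((nu.rowLen 0 + nu.rowLen 1 : ℕ) : ℝ) < ((N + 1 : ℕ) : ℝ) := by
      push_cast
      constructor <;> intro h <;> linarith
    rw [this, Nat.cast_lt, Nat.lt_succ_iff]

/-- The uniform condition reads `2ν₀ < N + 2`, equivalent to `2ν₀ ≤ N` only because `N` is even. -/
theorem limitB_eq {N : ℕ} (hN : Even N) : limitB N = limitDatum 1 (-(N : ℝ) / 2 - 1) := by
  unfold limitB limitDatum specialRefl
  congr 1
  · funext i
    ring
  · ext x
    refine exists_congr fun nu => and_congr_left fun _ => ?_
    have : (nu.rowLen 0 : ℝ) + nu.rowLen (1 - 1) + 2 * (-(N : ℝ) / 2 - 1) < ((1 - 1 : ℕ) : ℝ) ↔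
        ((2 * nu.rowLen 0 : ℕ) : ℝ) < ((N + 2 : ℕ) : ℝ) := by
      push_cast
      constructor <;> intro h <;> linarith
    rw [this, Nat.cast_lt]
    obtain ⟨n, rfl⟩ := hN
    omega

/-- The hypothesis makes the two vectors `ρ` coincide; for `r = -N/2` it says `ℓ = N + 2m - 1`,
which is `N + M - 2`. -/
theorem affineB_eq {m ℓ : ℕ} {r : ℝ} (h : r + ℓ / 2 = m - 1 / 2) :
    affineB m ℓ = affineDatum 2 m ℓ r := by
  have hrho : rhoB m = fun i : Fin m => r - i + ℓ / ((2 : ℕ) : ℝ) := by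
    funext i
    rw [rhoB]
    push_cast
    linarith
  unfold affineB affineDatum
  congr 1
  ext x
  rw [hrho]
  refine and_congr Iff.rfl (and_congr Iff.rfl ?_)
  have : 2 * ((ℓ : ℝ) / ((2 : ℕ) : ℝ)) = ℓ := by
    push_cast
    ring
  rw [this]
  rfl

theorem affineC_eq {m ℓ : ℕ} {r : ℝ} (h : r + ℓ = m) :
    affineC m ℓ = affineDatum 1 m ℓ r := by
  have hrho : rhoC m = fun i : Fin m => r - i + ℓ / ((1 : ℕ) : ℝ) := by
    funext i
    rw [rhoC]
    push_cast
    linarith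
  unfold affineC affineDatum
  congr 1
  · simp only [Nat.lt_one_iff]
  · ext x
    rw [hrho]
    refine and_congr Iff.rfl (and_congr Iff.rfl ?_)
    simp only [Nat.cast_one, div_one, Pi.add_apply, Nat.sub_self]
    constructor
    · intro hx i j hi hj
      have hij : i = j := Fin.ext (hi.trans hj.symm)
      subst hij
      have := hx i hi
      linarith
    · intro hx i hi
      have := hx i i hi hi
      linarith

end KLStab

end

theorem lemma5p2 (N : ℕ) (hN : 0 < N) (lam mu : YoungDiagram) :
    ((KLStab.limitD N).Regular (KLStab.seq lam) →
      (KLStab.limitD N).Admissible (KLStab.seq lam) ∧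
      ∃ M₀ : ℕ, ∀ M : ℕ, M₀ ≤ M → Odd M →
        (KLStab.affineB (M / 2) (N + M - 2)).Admissible (KLStab.vec (M / 2) lam) ∧
        KLStab.aSO M (N + M - 2) lam mu = KLStab.aSOlim N lam mu) ∧
    (Even N → (KLStab.limitB N).Regular (KLStab.seq lam) →
      (KLStab.limitB N).Admissible (KLStab.seq lam) ∧
      ∃ M₀ : ℕ, ∀ M : ℕ, M₀ ≤ M → Even M →
        (KLStab.affineC (M / 2) ((N + M + 2) / 2)).Admissible (KLStab.vec (M / 2) lam) ∧
        KLStab.aSp M ((N + M + 2) / 2) lam mu = KLStab.aSplim N lam mu) := by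
  constructor
  · intro hreg
    rw [KLStab.limitD_eq] at hreg
    obtain ⟨hadm, m₀, h⟩ := KLStab.stabilization (Or.inr rfl) ⟨-N, by push_cast; ring⟩ lam mu hreg
    rw [KLStab.aSOlim, KLStab.limitD_eq]
    -- The margin `3` keeps `ℓ = N + M - 2` positive.
    refine ⟨hadm, 2 * m₀ + 3, ?_⟩
    rintro _ hM ⟨m, rfl⟩
    have hℓ : ((N + (2 * m + 1) - 2 : ℕ) : ℝ) = N + 2 * m - 1 := by
      rw [Nat.cast_sub (by omega)]
      push_cast
      ring
    have hm : (2 * m + 1) / 2 = m := by omega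
    rw [KLStab.aSO, KLStab.affineB_eq (r := -(N : ℝ) / 2) (by rw [hm, hℓ]; ring)]
    refine h _ (by omega) _ (by omega) ?_
    rw [hm, hℓ]
    push_cast
    linarith
  · intro hN2 hreg
    rw [KLStab.limitB_eq hN2] at hreg
    obtain ⟨hadm, m₀, h⟩ :=
      KLStab.stabilization (Or.inl rfl) ⟨-N - 2, by push_cast; ring⟩ lam mu hreg
    rw [KLStab.aSplim, KLStab.limitB_eq hN2]
    refine ⟨hadm, 2 * m₀, ?_⟩
    intro M hM hM2
    obtain ⟨m, rfl⟩ := even_iff_exists_two_mul.1 hM2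
    obtain ⟨n, rfl⟩ := even_iff_exists_two_mul.1 hN2
    have hℓ : (2 * n + 2 * m + 2) / 2 = n + m + 1 := by omega
    have hm : 2 * m / 2 = m := by omega
    rw [KLStab.aSp, hℓ, KLStab.affineC_eq (r := -((2 * n : ℕ) : ℝ) / 2 - 1) (by
      rw [hm]
      push_cast
      ring)]
    refine h _ (by omega) _ (by omega) ?_
    rw [hm]
    push_cast
    linarith
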